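/- **Setting.** A space of graphs $\mathcal G$ is a family of finite simple graphs, and a node coloring $\mathcal C$ of $\mathcal G$ with values in $\chi\subseteq\mathbb R^N$ assigns a feature $\mathcal C(v)\in\chi$ to every node $v$ of every $G\in\mathcal G$. It satisfies the *degree assumption* if any two nodes (possibly of different graphs in $\mathcal G$) of the same color have the same degree. A *stable WL coloring* (from constant initial colors) is one with $\mathcal C(u)=\mathcal C(v)$ if and only if $u$ and $v$ have the same color $X_t$ after every number $t$ of rounds of the Weisfeiler–Lehman refinement $X_{t+1}(v)=\big(X_t(v),\{\{X_t(w): w\sim v\}\}\big)$, $X_0$ constant. *Persistence diagrams.* For a matrix $M$ of (possibly infinite) distances on a finite set $V$, $\mathrm{VR}_1^\varepsilon(V,M)$ is the $1$-skeleton of its Vietoris–Rips complex at scale $\varepsilon$, and $\mathrm{ph}^i$ denotes the $i$-th persistence diagram over $\mathbb Z/2$, a multiset of points $(b,d)$ with $b<d\le\infty$. *TED.* An *injective edge filtration* for $\mathcal C$ is a positive, bounded, injective real function $ef$ on the set of colored edges $\{\{\mathcal C(u),\mathcal C(v)\}\}$, $uv\in E(G)$, $G\in\mathcal G$. $\mathrm{TED}(G,ef)=(\mathrm{ph}^0,\mathrm{ph}^1)$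 of $\{\mathrm{VR}^\varepsilon_1(V(G),M)\}_{\varepsilon\ge 0}$, where $M$ is $0$ on the diagonal, $ef(\{\{\mathcal C(u),\mathcal C(v)\}\})$ if $uv\in E(G)$, and $\infty$ otherwise. *LGVR.* Its weights $\theta$ consist of a multi-layer perceptron $m:\mathbb R^N\to\mathbb R^N$ (ReLU, at least one hidden layer), a scalar $\eta$, a dimension $d$, and two node-level graph isomorphism networks $P_1$ (features $\mathbb R^{2N}\to\mathbb R^d$) and $P_2$ (features $\mathbb R^d\to\mathbb R$) with at least one layer each, a layer being $h_v\mapsto \mathrm{MLP}\big((1+\epsilon)h_v+\sum_{w\sim v}h_w\big)$. Put $x'=x+\eta\, m(x)$ and $\phi(\{\{x,y\}\})=(x'+y',|x'-y'|)\in\mathbb R^{2N}$ (componentwise absolute value). Given $(G,\mathcal C)$: color each edge $uv$ of $G$ (a node of the line graph $L_G$) by $\phi(\{\{\mathcal C(u),\mathcal C(v)\}\})$ and apply $P_1$ on $L_G$; extend the resulting features by $0$ to the line graph $L_{K_G}$ of the complete graph on $V(G)$; apply $P_2$ on $L_{K_G}$ followed by the logistic sigmoid. The resulting values, with zero diagonal,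 form the matrix $A_G^{\mathcal C}$, and $\mathrm{LGVR}_\theta(G,\mathcal C)=(\mathrm{ph}^0,\mathrm{ph}^1)$ of $\{\mathrm{VR}_1^\varepsilon(V(G),A_G^{\mathcal C})\}_{\varepsilon\in[0,1/2]}$. **Theorem.** Let $\chi\subseteq\mathbb R^N$ be countable. Then there are weights $\theta$ (depending only on $N$ and $\chi$) such that for every space of graphs $\mathcal G$ and every node coloring $\mathcal C$ of $\mathcal G$ with values in $\chi$ the following holds. 1. Suppose that $\mathcal C$ satisfies the degree assumption. If $G,H\in\mathcal G$ have no isolated nodes and $\{\{\mathcal C(v): v\in V(G)\}\}\ne\{\{\mathcal C(v): v\in V(H)\}\}$, then $\mathrm{LGVR}_\theta(G,\mathcal C)\ne\mathrm{LGVR}_\theta(H,\mathcal C)$. 2. Suppose that $\mathcal C$ is a stable WL coloring. If $G,H\in\mathcal G$ satisfy $\{\{\mathcal C(v): v\in V(G)\}\}\ne\{\{\mathcal C(v): v\in V(H)\}\}$ (they are distinguished by WL), then $\mathrm{LGVR}_\theta(G,\mathcal C)\ne\mathrm{LGVR}_\theta(H,\mathcal C)$. Moreover, if $\mathcal G$ contains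 every finite simple graph up to isomorphism, there are $G,H\in\mathcal G$ with $\{\{\mathcal C(v): v\in V(G)\}\}=\{\{\mathcal C(v): v\in V(H)\}\}$ (not distinguished by WL) and $\mathrm{LGVR}_\theta(G,\mathcal C)\ne\mathrm{LGVR}_\theta(H,\mathcal C)$. 3. LGVR shares these separation properties with TED: in 1 and in both parts of 2 (with the same pair $G,H$) also $\mathrm{TED}(G,ef)\ne\mathrm{TED}(H,ef)$ for every injective edge filtration $ef$ for $\mathcal C$. -/

import Mathlib

open scoped NNReal

universe u v

namespace TopEdge

noncomputable section

/-! ### Graph spaces, node colorings, colored edges -/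

set_option linter.checkUnivs false in
/-- A space of finite simple graphs: a family of finite simple graphs indexed by an arbitrary type.
The same graph may occur several times (with different node colorings). -/
structure GraphSpace where
  Idx : Type u
  V : Idx → Type v
  [finite : ∀ G, Fintype (V G)]
  graph : ∀ G, SimpleGraph (V G)

attribute [instance] GraphSpace.finite

/-- The node features: vectors in `ℝ ^ N`. -/
abbrev Feature (N : ℕ) : Type := Fin N → ℝ

/-- A node coloring assigns a node feature to every node of every graph of the space. -/
abbrev NodeColoring (𝒢 : GraphSpace.{u, v}) (N : ℕ) : Type (max u v) :=
  ∀ G : 𝒢.Idx, 𝒢.V G → Feature N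

/-- The multiset of node colors of a graph. -/
def colorMultiset {𝒢 : GraphSpace.{u, v}} {N : ℕ} (C : NodeColoring 𝒢 N) (G : 𝒢.Idx) :
    Multiset (Feature N) :=
  Finset.univ.val.map (C G)

/-- No vertex is isolated. -/
def NoIsolated {V : Type v} (g : SimpleGraph V) : Prop :=
  ∀ w, ∃ w', g.Adj w w'

open Classical in
/-- The degree assumption: nodes of the same color (possibly in different graphs of the space) have
the same degree. -/
def DegreeAssumption {𝒢 : GraphSpace.{u, v}} {N : ℕ} (C : NodeColoring 𝒢 N) : Prop :=
  ∀ (G H : 𝒢.Idx) (x : 𝒢.V G) (y : 𝒢.V H),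
    C G x = C H y → (𝒢.graph G).degree x = (𝒢.graph H).degree y

/-- Every finite simple graph is isomorphic to a member of the space. -/
def ContainsAllFiniteGraphs (𝒢 : GraphSpace.{u, v}) : Prop :=
  ∀ (n : ℕ) (g : SimpleGraph (Fin n)), ∃ G : 𝒢.Idx, Nonempty (g ≃g 𝒢.graph G)

/-! ### The Weisfeiler-Lehman test -/

/-- The colors after `t` rounds of the Weisfeiler-Lehman refinement. The new color of a node is the
pair (old color, multiset of old colors of the neighbors), i.e. the hash is the identity. -/
def WLColor : ℕ → Type
  | 0 => Unit
  | t + 1 => WLColor t × Multiset (WLColor t)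

open Classical in
/-- The Weisfeiler-Lehman color of a node after `t` rounds, from the constant initial coloring. -/
def wlColor {V : Type v} [Fintype V] (g : SimpleGraph V) : (t : ℕ) → V → WLColor t
  | 0 => fun _ => ()
  | t + 1 => fun x => (wlColor g t x, (g.neighborFinset x).val.map (wlColor g t))

/-- `C` is a stable Weisfeiler-Lehman coloring (all initial colors being the same): two nodes,
possibly in different graphs, get the same feature iff no round of the refinement tells
them apart. -/
def IsStableWL {𝒢 : GraphSpace.{u, v}} {N : ℕ} (C : NodeColoring 𝒢 N) : Prop :=
  ∀ (G H : 𝒢.Idx) (x : 𝒢.V G) (y : 𝒢.V H),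
    C G x = C H y ↔ ∀ t, wlColor (𝒢.graph G) t x = wlColor (𝒢.graph H) t y

/-! ### Simplicial chains over `ℤ / 2` and persistence diagrams -/

section Persistence

variable {V : Type v}

/-- The space containing the chains of all degrees: formal sums of finite vertex sets. -/
abbrev Chain (V : Type v) : Type v := Finset V →₀ ZMod 2

/-- The `n`-chains of a simplicial complex: the span of its simplices with `n + 1` vertices. -/
def chains (n : ℕ) (K : PreAbstractSimplicialComplex V) : Submodule (ZMod 2) (Chain V) :=
  Finsupp.supported (ZMod 2) (ZMod 2) {σ : Finset V | σ ∈ K ∧ σ.card = n + 1}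

open Classical in
/-- The simplicial boundary: a simplex goes to the sum of its facets, a vertex goes to `0`. -/
def boundary (V : Type v) : Chain V →ₗ[ZMod 2] Chain V :=
  Finsupp.linearCombination (ZMod 2) fun σ : Finset V =>
    ∑ x ∈ σ, if (σ.erase x).Nonempty then Finsupp.single (σ.erase x) (1 : ZMod 2) else 0

/-- The `n`-cycles of a simplicial complex. -/
def cycles (n : ℕ) (K : PreAbstractSimplicialComplex V) : Submodule (ZMod 2) (Chain V) :=
  chains n K ⊓ LinearMap.ker (boundary V)

/-- The `n`-boundaries of a simplicial complex. -/
def boundaries (n : ℕ) (K : PreAbstractSimplicialComplex V) : Submodule (ZMod 2) (Chain V) :=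
  (chains (n + 1) K).map (boundary V)

/-- The dimension of the quotient `A / B` of a subspace `A` by a subspace `B ≤ A`. -/
def quotientDim {F E : Type*} [Field F] [AddCommGroup E] [Module F E] (A B : Submodule F E) : ℕ :=
  Module.finrank F (↥A ⧸ B.submoduleOf A)

variable {T : Type*} [LinearOrder T]

/-- The chains that are dead at time `d`: the boundaries at time `d`; everything is
dead at time `∞`. -/
def deadBy (n : ℕ) (K : T → PreAbstractSimplicialComplex V) :
    WithTop T → Submodule (ZMod 2) (Chain V)
  | ⊤ => ⊤
  | (t : T) => boundaries n (K t)

/-- The `n`-th persistence diagram of a filtration, as a multiset of points `(b, d)` (birth, death)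
with `b < d ≤ ∞`, given by its multiplicity function. The multiplicity of `(b, d)` is the dimension
of the space of `n`-cycles that exist at time `b` and are dead at time `d`, modulo those that exist
before time `b` and those that are dead before time `d`. -/
def persistenceDiagram (n : ℕ) (K : T → PreAbstractSimplicialComplex V) :
    T → WithTop T → ℕ := fun b d =>
  open Classical in
  if (b : WithTop T) < d then
    let born : Submodule (ZMod 2) (Chain V) := cycles n (K b)
    let bornBefore : Submodule (ZMod 2) (Chain V) := ⨆ (s : T) (_ : s < b), cycles n (K s)
    let dead : Submodule (ZMod 2) (Chain V) := deadBy n K d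
    let deadBefore : Submodule (ZMod 2) (Chain V) := ⨆ (s : WithTop T) (_ : s < d), deadBy n K s
    quotientDim (born ⊓ dead) ((bornBefore ⊓ dead) ⊔ (born ⊓ deadBefore))
  else 0

/-- The `k`-skeleton of the Vietoris-Rips complex of scale `ε` of a finite point cloud with a matrix
of (possibly infinite) distances: the nonempty sets of at most `k + 1` points, any two of which are
at distance at most `ε`. -/
def vietorisRips (k : ℕ) (M : V → V → EReal) (ε : ℝ) : PreAbstractSimplicialComplex V where
  faces := {σ | σ.Nonempty ∧ σ.card ≤ k + 1 ∧ ∀ x ∈ σ, ∀ y ∈ σ, M x y ≤ (ε : EReal)}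
  isRelLowerSet_faces := by
    rintro σ ⟨hne, hcard, hM⟩
    refine ⟨hne, fun τ hτ hτne => ⟨hτne, (Finset.card_le_card hτ).trans hcard, ?_⟩⟩
    exact fun x hx y hy => hM x (hτ hx) y (hτ hy)

end Persistence

/-! ### Topological edge diagrams -/

/-- The set of colored edges `{{C x, C y}}`, over all edges of all graphs of the space. -/
def coloredEdges {𝒢 : GraphSpace.{u, v}} {N : ℕ} (C : NodeColoring 𝒢 N) :
    Set (Sym2 (Feature N)) :=
  {c | ∃ (G : 𝒢.Idx) (x y : 𝒢.V G), (𝒢.graph G).Adj x y ∧ c = s(C G x, C G y)}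

/-- An injective edge filtration: a positive, bounded and injective real function on the colored
edges (its values elsewhere play no role). -/
structure IsInjectiveEdgeFiltration {𝒢 : GraphSpace.{u, v}} {N : ℕ} (C : NodeColoring 𝒢 N)
    (ef : Sym2 (Feature N) → ℝ) : Prop where
  pos : ∀ c ∈ coloredEdges C, 0 < ef c
  bdd : BddAbove (ef '' coloredEdges C)
  inj : Set.InjOn ef (coloredEdges C)

open Classical in
/-- The distance matrix of an edge filtration: the value of the filtration on the edges, `∞` between
distinct nonadjacent nodes, and `0` on the diagonal. -/
def tedMatrix {𝒢 : GraphSpace.{u, v}} {N : ℕ} (C : NodeColoring 𝒢 N)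
    (ef : Sym2 (Feature N) → ℝ) (G : 𝒢.Idx) (x y : 𝒢.V G) : EReal :=
  if x = y then 0
  else if (𝒢.graph G).Adj x y then ((ef s(C G x, C G y) : ℝ) : EReal)
  else ⊤

/-- The topological edge diagram of a graph: the `0`-th and the `1`-st persistence diagram of the
`1`-skeleton of its Vietoris-Rips filtration, over all scales `ε ≥ 0`. -/
def TED {𝒢 : GraphSpace.{u, v}} {N : ℕ} (C : NodeColoring 𝒢 N)
    (ef : Sym2 (Feature N) → ℝ) (G : 𝒢.Idx) :
    (ℝ≥0 → WithTop ℝ≥0 → ℕ) × (ℝ≥0 → WithTop ℝ≥0 → ℕ) :=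
  (persistenceDiagram 0 fun ε : ℝ≥0 => vietorisRips 1 (tedMatrix C ef G) (ε : ℝ),
   persistenceDiagram 1 fun ε : ℝ≥0 => vietorisRips 1 (tedMatrix C ef G) (ε : ℝ))

/-! ### Multi-layer perceptrons and graph isomorphism networks -/

/-- The affine map with given weights and biases. -/
def affine {m n : ℕ} (W : Matrix (Fin n) (Fin m) ℝ) (b : Fin n → ℝ) (x : Fin m → ℝ) : Fin n → ℝ :=
  W.mulVec x + b

/-- The componentwise rectified linear unit. -/
def relu {n : ℕ} (x : Fin n → ℝ) : Fin n → ℝ := fun i => max (x i) 0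

/-- The weights of a multi-layer perceptron `ℝ ^ m → ℝ ^ n` with at least one hidden layer. -/
inductive MLP : ℕ → ℕ → Type
  | shallow {m k n : ℕ} (W₁ : Matrix (Fin k) (Fin m) ℝ) (b₁ : Fin k → ℝ)
      (W₂ : Matrix (Fin n) (Fin k) ℝ) (b₂ : Fin n → ℝ) : MLP m n
  | deeper {m k n : ℕ} (W : Matrix (Fin k) (Fin m) ℝ) (b : Fin k → ℝ) (rest : MLP k n) : MLP m n

/-- The map computed by a multi-layer perceptron with ReLU activations after the hidden layers. -/
def MLP.eval : {m n : ℕ} → MLP m n → (Fin m → ℝ) → (Fin n → ℝ)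
  | _, _, .shallow W₁ b₁ W₂ b₂, x => affine W₂ b₂ (relu (affine W₁ b₁ x))
  | _, _, .deeper W b rest, x => rest.eval (relu (affine W b x))

open Classical in
/-- One layer of a graph isomorphism network:
`h x ↦ MLP ((1 + ε) h x + ∑ h y)`, the sum being over the neighbors `y` of `x`. -/
def ginLayer {m n : ℕ} (ε : ℝ) (p : MLP m n) {V : Type v} [Fintype V] (g : SimpleGraph V)
    (h : V → Fin m → ℝ) : V → Fin n → ℝ :=
  fun x => p.eval ((1 + ε) • h x + ∑ y ∈ g.neighborFinset x, h y)

/-- The weights of a node-level graph isomorphism network with at least one layer, taking node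
features in `ℝ ^ m` to node features in `ℝ ^ n`. -/
inductive GIN : ℕ → ℕ → Type
  | last {m n : ℕ} (ε : ℝ) (p : MLP m n) : GIN m n
  | layer {m k n : ℕ} (ε : ℝ) (p : MLP m k) (rest : GIN k n) : GIN m n

/-- The node features computed by a graph isomorphism network on a graph with node features. -/
def GIN.eval {V : Type v} [Fintype V] (g : SimpleGraph V) :
    {m n : ℕ} → GIN m n → (V → Fin m → ℝ) → V → Fin n → ℝ
  | _, _, .last ε p, h => ginLayer ε p g h
  | _, _, .layer ε p rest, h => rest.eval g (ginLayer ε p g h)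

/-! ### Line graph Vietoris-Rips persistence diagrams -/

/-- The weights of an LGVR network on node features in `ℝ ^ N`: the perceptron and the scalar of the
edge coloring `φ`, a graph isomorphism network on the line graph, and a graph isomorphism network
with scalar output on the line graph of the complete graph. -/
structure LGVRWeights (N : ℕ) where
  mlp : MLP N N
  η : ℝ
  d : ℕ
  P₁ : GIN (N + N) d
  P₂ : GIN d 1

/-- The map `x ↦ x + η • mlp x`. -/
def shifted {N : ℕ} (θ : LGVRWeights N) (x : Feature N) : Feature N :=
  x + θ.η • θ.mlp.eval x

/-- The edge coloring `φ {{x, y}} = (x' + y', |x' - y'|)` in `ℝ ^ (2 N)`, where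
`x' = x + η • mlp x`, `y' = y + η • mlp y` and the absolute value is componentwise. -/
def phi {N : ℕ} (θ : LGVRWeights N) : Sym2 (Feature N) → (Fin (N + N) → ℝ) :=
  Sym2.lift ⟨fun x y =>
    Fin.append (shifted θ x + shifted θ y) (fun i => |shifted θ x i - shifted θ y i|),
    fun x y => by simp only [add_comm, abs_sub_comm]⟩

section LGVR

variable {N : ℕ} (θ : LGVRWeights N) {V : Type v} [Fintype V] (g : SimpleGraph V)
  (c : V → Feature N)

open Classical in
/-- The features on the nodes of the line graph (the edges `{x, y}`): `P₁` applied to the coloring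
`φ {{c x, c y}}`. -/
def lineFeatures : g.edgeSet → Fin θ.d → ℝ :=
  θ.P₁.eval g.lineGraph fun e => phi θ ((e : Sym2 V).map c)

open Classical in
/-- The features of the line graph, extended by zero to the line graph of the complete graph. -/
def extendedFeatures : (⊤ : SimpleGraph V).edgeSet → Fin θ.d → ℝ := fun e =>
  if h : (e : Sym2 V) ∈ g.edgeSet then lineFeatures θ g c ⟨e, h⟩ else 0

open Classical in
/-- The value of every edge of the complete graph: `P₂`, made `[0, 1]`-valued by the logistic
sigmoid, applied to the extended features. -/
def edgeValue (e : (⊤ : SimpleGraph V).edgeSet) : ℝ :=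
  Real.sigmoid (θ.P₂.eval (⊤ : SimpleGraph V).lineGraph (extendedFeatures θ g c) e 0)

open Classical in
/-- The edge filtration matrix. -/
def edgeMatrix (x y : V) : ℝ :=
  if h : x = y then 0
  else edgeValue θ g c ⟨s(x, y), (SimpleGraph.mem_edgeSet _).2 ((SimpleGraph.top_adj x y).2 h)⟩

/-- The LGVR persistence diagram of a colored graph: the `0`-th and the `1`-st persistence diagram
of the `1`-skeleton of the Vietoris-Rips filtration of the edge filtration matrix, over the scales
`ε ∈ [0, 1 / 2]`. -/
def LGVR :
    (Set.Icc (0 : ℝ) (1 / 2) → WithTop (Set.Icc (0 : ℝ) (1 / 2)) → ℕ) ×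
      (Set.Icc (0 : ℝ) (1 / 2) → WithTop (Set.Icc (0 : ℝ) (1 / 2)) → ℕ) :=
  (persistenceDiagram 0 fun ε : Set.Icc (0 : ℝ) (1 / 2) =>
      vietorisRips 1 (fun x y => ((edgeMatrix θ g c x y : ℝ) : EReal)) (ε : ℝ),
   persistenceDiagram 1 fun ε : Set.Icc (0 : ℝ) (1 / 2) =>
      vietorisRips 1 (fun x y => ((edgeMatrix θ g c x y : ℝ) : EReal)) (ε : ℝ))

end LGVR

end

end TopEdge

namespace TopEdge

/-! ### Linear algebra of the chain complexes of graphs -/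

/-! Each edge that enters a filtration of `1`-skeletons either merges two components, which is a
death in `ph⁰`, or closes a cycle, which is a birth in `ph¹` of a class that never dies, there being
no triangles. By rank-nullity the number of edges entering at a time `b > 0` is therefore the
multiplicity of `(0, b)` in `ph⁰` plus that of `(b, ∞)` in `ph¹` (`ncard_edges_at`). Moreover `ph⁰`
alone determines the number of nodes (`card_eq_of_persistenceDiagram_zero`).

For TED, injectivity of `ef` turns these counts into the multiset of colored edges. That multiset
gives the number of edge ends of each color `k`. Dividing by the common degree of the nodes of color
`k` gives the number of these nodes, provided the degree is positive (`count_map_eq_of_degree`). In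
a stable WL coloring the isolated nodes share a single color, and its multiplicity follows from the
total number of nodes (`IsStableWL.colorMultiset_eq`).

For LGVR it suffices that the value of a pair of nodes reveals whether the pair is an edge and, if
so, its colors. As `χ` is countable, the finite sums of features that can reach a layer, over all
graphs at once, form a countable set. Each parameter then only has to avoid countably many bad
values for the layer to be decodable (`exists_weights`). A final negated ReLU keeps all values in
`(0, 1/2]`, so that no pair escapes the observed scales.

The extra pair is the hexagon and two disjoint triangles. Both are `2`-regular, so all their nodes
have the same WL color. In both filtrations all edges enter together, strictly before every
nonadjacent pair, and at that time `ph⁰` sees that one graph is connected and the other is not. -/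

theorem quotientDim_add_finrank {F E : Type*} [Field F] [AddCommGroup E] [Module F E]
    [FiniteDimensional F E] {A B : Submodule F E} (h : B ≤ A) :
    quotientDim A B + Module.finrank F B = Module.finrank F A := by
  have := Submodule.finrank_quotient_add_finrank (B.submoduleOf A)
  rwa [(Submodule.submoduleOfEquivOfLe h).finrank_eq] at this

theorem finrank_map_add_finrank_inf_ker {F E E' : Type*} [Field F] [AddCommGroup E] [Module F E]
    [AddCommGroup E'] [Module F E'] [FiniteDimensional F E] (f : E →ₗ[F] E') (A : Submodule F E) :
    Module.finrank F (A.map f) + Module.finrank F ↥(A ⊓ LinearMap.ker f) = Module.finrank F A := by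
  have h := LinearMap.finrank_range_add_finrank_ker (f.domRestrict A)
  rw [LinearMap.range_domRestrict] at h
  have : LinearMap.ker (f.domRestrict A) = (A ⊓ LinearMap.ker f).submoduleOf A := by
    ext ⟨x, hx⟩
    simp [Submodule.submoduleOf]
  rwa [this, (Submodule.submoduleOfEquivOfLe inf_le_left).finrank_eq] at h

section

variable {V : Type v}

theorem mem_vietorisRips {k : ℕ} {M : V → V → EReal} {ε : ℝ} {σ : Finset V} :
    σ ∈ vietorisRips k M ε ↔
      σ.Nonempty ∧ σ.card ≤ k + 1 ∧ ∀ x ∈ σ, ∀ y ∈ σ, M x y ≤ (ε : EReal) :=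
  Iff.rfl

theorem chains_mono (n : ℕ) {K L : PreAbstractSimplicialComplex V} (h : ∀ σ ∈ K, σ ∈ L) :
    chains n K ≤ chains n L :=
  Finsupp.supported_mono fun σ hσ => ⟨h σ hσ.1, hσ.2⟩

theorem boundaries_mono (n : ℕ) {K L : PreAbstractSimplicialComplex V} (h : ∀ σ ∈ K, σ ∈ L) :
    boundaries n K ≤ boundaries n L :=
  Submodule.map_mono (chains_mono _ h)

theorem cycles_mono (n : ℕ) {K L : PreAbstractSimplicialComplex V} (h : ∀ σ ∈ K, σ ∈ L) :
    cycles n K ≤ cycles n L :=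
  inf_le_inf_right _ (chains_mono _ h)

/-- The span of the vertices. -/
def vertexChains (V : Type v) : Submodule (ZMod 2) (Chain V) :=
  Finsupp.supported (ZMod 2) (ZMod 2) {σ : Finset V | σ.card = 1}

theorem finrank_supported [Fintype V] (s : Set (Finset V)) :
    Module.finrank (ZMod 2) (Finsupp.supported (ZMod 2) (ZMod 2) s) = s.ncard := by
  classical
  rw [(Finsupp.supportedEquivFinsupp s).finrank_eq, Module.finrank_finsupp_self,
    ← Nat.card_eq_fintype_card, Nat.card_coe_set_eq]

theorem finrank_vertexChains [Fintype V] :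
    Module.finrank (ZMod 2) (vertexChains V) = Fintype.card V := by
  classical
  rw [vertexChains, finrank_supported, Set.ncard_eq_toFinset_card',
    ← Nat.choose_one_right (Fintype.card V), ← Finset.card_univ,
    ← Finset.card_powersetCard]
  congr 1
  ext σ
  simp [Finset.mem_powersetCard]

theorem boundary_single (σ : Finset V) [DecidableEq V] :
    boundary V (Finsupp.single σ 1) = ∑ x ∈ σ, if (σ.erase x).Nonempty then
      Finsupp.single (σ.erase x) (1 : ZMod 2) else 0 := by
  classical
  simp only [boundary, Finsupp.linearCombination_single, one_smul]
  refine Finset.sum_congr rfl fun x _ => ?_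
  congr!

theorem boundary_vertex (x : V) : boundary V (Finsupp.single {x} 1) = 0 := by
  classical
  simp [boundary_single]

theorem boundary_edge {x y : V} [DecidableEq V] (h : x ≠ y) :
    boundary V (Finsupp.single {x, y} 1) = Finsupp.single {x} 1 + Finsupp.single {y} 1 := by
  rw [boundary_single, Finset.sum_pair h, Finset.erase_insert (by simpa using h),
    Finset.pair_comm, Finset.erase_insert (by simpa using h.symm)]
  simp [add_comm]

theorem vertexChains_le_ker : vertexChains V ≤ LinearMap.ker (boundary V) := by
  classical
  rw [vertexChains, Finsupp.supported_eq_span_single, Submodule.span_le]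
  rintro _ ⟨σ, hσ, rfl⟩
  obtain ⟨x, rfl⟩ := Finset.card_eq_one.1 hσ
  simpa using boundary_vertex x

theorem boundaries_zero_le (K : PreAbstractSimplicialComplex V) :
    boundaries 0 K ≤ vertexChains V := by
  classical
  rw [boundaries, chains, Finsupp.supported_eq_span_single, Submodule.map_span, Submodule.span_le]
  rintro _ ⟨_, ⟨σ, hσ, rfl⟩, rfl⟩
  obtain ⟨x, y, hxy, rfl⟩ := Finset.card_eq_two.1 hσ.2
  rw [boundary_edge hxy]
  exact add_mem (Finsupp.single_mem_supported _ _ (by simp))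
    (Finsupp.single_mem_supported _ _ (by simp))

theorem finrank_boundaries_add_finrank_cycles [Fintype V] (K : PreAbstractSimplicialComplex V) :
    Module.finrank (ZMod 2) (boundaries 0 K) + Module.finrank (ZMod 2) (cycles 1 K) =
      {σ | σ ∈ K ∧ σ.card = 2}.ncard := by
  rw [← finrank_supported]
  exact finrank_map_add_finrank_inf_ker (boundary V) (chains 1 K)

theorem boundaries_one_vietorisRips (M : V → V → EReal) (ε : ℝ) :
    boundaries 1 (vietorisRips 1 M ε) = ⊥ := by
  have : {σ : Finset V | σ ∈ vietorisRips 1 M ε ∧ σ.card = 1 + 1 + 1} = ∅ := by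
    ext σ
    simp only [mem_vietorisRips, Set.mem_ofPred_eq, Set.mem_empty_iff_false, iff_false]
    omega
  rw [boundaries, chains, this, Finsupp.supported_empty, Submodule.map_bot]

theorem vietorisRips_mono {M : V → V → EReal} {ε δ : ℝ} (h : ε ≤ δ) :
    ∀ σ ∈ vietorisRips 1 M ε, σ ∈ vietorisRips 1 M δ := fun _ hσ =>
  ⟨hσ.1, hσ.2.1, fun x hx y hy => (hσ.2.2 x hx y hy).trans (by exact_mod_cast h)⟩

theorem cycles_zero_vietorisRips {M : V → V → EReal} (h0 : ∀ x, M x x = 0) {ε : ℝ} (hε : 0 ≤ ε) :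
    cycles 0 (vietorisRips 1 M ε) = vertexChains V := by
  have : chains 0 (vietorisRips 1 M ε) = vertexChains V := by
    rw [chains, vertexChains]
    congr 1
    ext σ
    simp only [mem_vietorisRips, Set.mem_ofPred_eq, zero_add, and_iff_right_iff_imp]
    intro hσ
    obtain ⟨x, rfl⟩ := Finset.card_eq_one.1 hσ
    simpa [h0] using hε
  rw [cycles, this, inf_eq_left.2 vertexChains_le_ker]

end

/-! ### Persistence diagrams of the graph filtrations -/

/-- A time axis: an interval of nonnegative reals with least element `0`. -/
structure IsTimeAxis {T : Type*} [LinearOrder T] (ι : T → ℝ) (o : T) : Prop where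
  mono : StrictMono ι
  zero : ι o = 0
  least : ∀ t, o ≤ t
  filled : ∀ t r, 0 ≤ r → r ≤ ι t → ∃ s, ι s = r

theorem isTimeAxis_nnreal : IsTimeAxis (fun t : ℝ≥0 => (t : ℝ)) 0 where
  mono _ _ h := h
  zero := rfl
  least _ := zero_le
  filled _ r hr _ := ⟨⟨r, hr⟩, rfl⟩

theorem isTimeAxis_Icc :
    IsTimeAxis (fun t : Set.Icc (0 : ℝ) (1 / 2) => (t : ℝ)) ⟨0, by norm_num⟩ where
  mono _ _ h := h
  zero := rfl
  least t := t.2.1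
  filled t r hr h := ⟨⟨r, hr, h.trans t.2.2⟩, rfl⟩

/-- The distance matrix given by the function `w` on pairs, zero on the diagonal. -/
structure IsPairMatrix {V : Type v} (M : V → V → EReal) (w : Sym2 V → EReal) : Prop where
  diag : ∀ x, M x x = 0
  offDiag : ∀ x y, x ≠ y → M x y = w s(x, y)
  pos : ∀ e, ¬ e.IsDiag → 0 < w e

section

variable {V : Type v} {T : Type*} [LinearOrder T] {ι : T → ℝ} {o : T}
  {M : V → V → EReal} {w : Sym2 V → EReal}

/-- The filtration by the `1`-skeletons of the Vietoris-Rips complexes. -/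
abbrev ripsFiltration (ι : T → ℝ) (M : V → V → EReal) (t : T) : PreAbstractSimplicialComplex V :=
  vietorisRips 1 M (ι t)

theorem IsTimeAxis.nonneg (hι : IsTimeAxis ι o) (t : T) : 0 ≤ ι t :=
  hι.zero ▸ hι.mono.monotone (hι.least t)

/-- `M` has finitely many entries. For each one that is reached before `d`, pick such a time, and
bound all the picked times. The suprema over earlier times in `persistenceDiagram` thus collapse to
a single time. -/
theorem exists_last [Finite V] (hι : IsTimeAxis ι o) (M : V → V → EReal) {d : WithTop T}
    (hd : (o : WithTop T) < d) :
    ∃ s : T, (s : WithTop T) < d ∧ ∀ s' : T, (s' : WithTop T) < d →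
      ∀ σ ∈ ripsFiltration ι M s', σ ∈ ripsFiltration ι M s := by
  classical
  have key : ∀ p : V × V, ∃ s : {s : T // (s : WithTop T) < d}, ∀ s' : T, (s' : WithTop T) < d →
      M p.1 p.2 ≤ (ι s' : EReal) → M p.1 p.2 ≤ (ι s : EReal) := by
    intro p
    by_cases h : ∃ s' : T, (s' : WithTop T) < d ∧ M p.1 p.2 ≤ (ι s' : EReal)
    · obtain ⟨s', h1, h2⟩ := h
      exact ⟨⟨s', h1⟩, fun _ _ _ => h2⟩
    · exact ⟨⟨o, hd⟩, fun s' h1 h2 => (h ⟨s', h1, h2⟩).elim⟩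
  choose f hf using key
  have : Nonempty {s : T // (s : WithTop T) < d} := ⟨⟨o, hd⟩⟩
  obtain ⟨s, hs⟩ := Finite.bddAbove_range f
  refine ⟨s, s.2, fun s' hs' σ hσ => ⟨hσ.1, hσ.2.1, fun x hx y hy => ?_⟩⟩
  refine (hf (x, y) s' hs' (hσ.2.2 x hx y hy)).trans ?_
  exact_mod_cast hι.mono.monotone (hs ⟨(x, y), rfl⟩)

/-- The time `s` is representative for all times shortly before `d`. -/
def IsLast (ι : T → ℝ) (M : V → V → EReal) (d : WithTop T) (s : T) : Prop :=
  (s : WithTop T) < d ∧ ∀ s' : T, (s' : WithTop T) < d →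
    ∀ σ ∈ ripsFiltration ι M s', σ ∈ ripsFiltration ι M s

theorem iSup_deadBy {n : ℕ} {d : WithTop T} {s : T} (hs : IsLast ι M d s) :
    ⨆ (t : WithTop T) (_ : t < d), deadBy n (ripsFiltration ι M) t =
      boundaries n (ripsFiltration ι M s) := by
  apply le_antisymm
  · refine iSup₂_le fun t ht => ?_
    cases t with
    | top => exact absurd ht not_top_lt
    | coe t => exact boundaries_mono n (hs.2 t ht)
  · exact le_iSup₂_of_le (s : WithTop T) hs.1 le_rfl

theorem iSup_cycles {n : ℕ} {b s : T} (hs : IsLast ι M b s) :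
    ⨆ (t : T) (_ : t < b), cycles n (ripsFiltration ι M t) = cycles n (ripsFiltration ι M s) := by
  apply le_antisymm
  · exact iSup₂_le fun t ht => cycles_mono n (hs.2 t (by exact_mod_cast ht))
  · exact le_iSup₂_of_le s (by exact_mod_cast hs.1) le_rfl

theorem iSup_lt_least (hι : IsTimeAxis ι o) {E : Type*} [CompleteLattice E] (f : T → E) :
    ⨆ (t : T) (_ : t < o), f t = ⊥ := by
  simp [(hι.least _).not_gt]

/-- All nodes are born at `o` and none earlier, so the multiplicity is the dimension of the
boundaries at `b` modulo those just before `b`. -/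
theorem persistenceDiagram_zero_finite [Fintype V] (hι : IsTimeAxis ι o) (hM : IsPairMatrix M w) {b s : T}
    (hob : o < b) (hs : IsLast ι M b s) :
    persistenceDiagram 0 (ripsFiltration ι M) o b +
        Module.finrank (ZMod 2) (boundaries 0 (ripsFiltration ι M s)) =
      Module.finrank (ZMod 2) (boundaries 0 (ripsFiltration ι M b)) := by
  have hob' : (o : WithTop T) < b := by exact_mod_cast hob
  rw [persistenceDiagram, if_pos hob']
  simp only
  rw [iSup_deadBy hs, iSup_lt_least hι, bot_inf_eq, bot_sup_eq,
    cycles_zero_vietorisRips hM.diag (hι.nonneg _)]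
  simp only [deadBy]
  rw [inf_eq_right.2 (boundaries_zero_le _), inf_eq_right.2 (boundaries_zero_le _)]
  refine quotientDim_add_finrank (boundaries_mono 0 (vietorisRips_mono ?_))
  exact hι.mono.monotone (by exact_mod_cast hs.1.le)

theorem persistenceDiagram_zero_top [Fintype V] (hι : IsTimeAxis ι o) (hM : IsPairMatrix M w) {s : T}
    (hs : IsLast ι M ⊤ s) :
    persistenceDiagram 0 (ripsFiltration ι M) o ⊤ +
        Module.finrank (ZMod 2) (boundaries 0 (ripsFiltration ι M s)) = Fintype.card V := by
  rw [persistenceDiagram, if_pos (WithTop.coe_lt_top o)]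
  simp only
  rw [iSup_deadBy hs, iSup_lt_least hι, bot_inf_eq, bot_sup_eq,
    cycles_zero_vietorisRips hM.diag (hι.nonneg _)]
  simp only [deadBy]
  rw [inf_eq_right.2 (boundaries_zero_le _), inf_top_eq,
    quotientDim_add_finrank (boundaries_zero_le _), finrank_vertexChains]

/-- A `1`-skeleton has no `1`-boundaries, so no cycle dies at a finite time and only the growth of
the cycle space is left. -/
theorem persistenceDiagram_one_top [Fintype V] (hι : IsTimeAxis ι o) {b s : T} (hs : IsLast ι M b s) :
    persistenceDiagram 1 (ripsFiltration ι M) b ⊤ +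
        Module.finrank (ZMod 2) (cycles 1 (ripsFiltration ι M s)) =
      Module.finrank (ZMod 2) (cycles 1 (ripsFiltration ι M b)) := by
  obtain ⟨s', hs'⟩ := exists_last hι M (WithTop.coe_lt_top o)
  rw [persistenceDiagram, if_pos (WithTop.coe_lt_top b)]
  simp only
  rw [iSup_deadBy hs', iSup_cycles hs]
  simp only [deadBy]
  rw [boundaries_one_vietorisRips, inf_bot_eq, sup_bot_eq, inf_top_eq, inf_top_eq]
  refine quotientDim_add_finrank (cycles_mono 1 (vietorisRips_mono ?_))
  exact hι.mono.monotone (by exact_mod_cast hs.1.le)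

theorem toFinset_mem_vietorisRips (hM : IsPairMatrix M w) [DecidableEq V] {e : Sym2 V}
    (he : ¬ e.IsDiag) {ε : ℝ} (hε : 0 ≤ ε) :
    e.toFinset ∈ vietorisRips 1 M ε ↔ w e ≤ (ε : EReal) := by
  have hε' : (0 : EReal) ≤ (ε : EReal) := by exact_mod_cast hε
  induction e with | _ x y
  have hxy : x ≠ y := by simpa using he
  rw [mem_vietorisRips, Sym2.toFinset_mk_eq]
  simp [hM.diag, hM.offDiag x y hxy, hM.offDiag y x hxy.symm, Sym2.eq_swap (a := y), hε',
    Finset.card_pair hxy]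

theorem ncard_edges [Fintype V] (hM : IsPairMatrix M w) {ε : ℝ} (hε : 0 ≤ ε) :
    {σ | σ ∈ vietorisRips 1 M ε ∧ σ.card = 2}.ncard =
      {e : Sym2 V | ¬ e.IsDiag ∧ w e ≤ (ε : EReal)}.ncard := by
  classical
  symm
  refine Set.ncard_congr (fun e _ => e.toFinset) ?_ ?_ ?_
  · rintro e ⟨h1, h2⟩
    exact ⟨(toFinset_mem_vietorisRips hM h1 hε).2 h2, Sym2.card_toFinset_of_not_isDiag e h1⟩
  · intro e f _ _ h
    ext x
    rw [← Sym2.mem_toFinset, h, Sym2.mem_toFinset]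
  · rintro σ ⟨h1, h2⟩
    obtain ⟨x, y, hxy, rfl⟩ := Finset.card_eq_two.1 h2
    have hd : ¬ (s(x, y)).IsDiag := by simpa using hxy
    refine ⟨s(x, y), ⟨hd, ?_⟩, Sym2.toFinset_mk_eq⟩
    rw [← toFinset_mem_vietorisRips hM hd hε, Sym2.toFinset_mk_eq]
    exact h1

/-- A value of the filtration below a time `b` is attained before `b`. -/
theorem IsTimeAxis.exists_lt (hι : IsTimeAxis ι o) {b : T} {a : EReal} (h0 : 0 ≤ a)
    (h : a < (ι b : EReal)) : ∃ t < b, a = (ι t : EReal) := by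
  lift a to ℝ using ⟨ne_top_of_lt h, ne_bot_of_gt (lt_of_lt_of_le (EReal.bot_lt_zero) h0)⟩
  have h0' : 0 ≤ a := by exact_mod_cast h0
  have h' : a < ι b := by exact_mod_cast h
  obtain ⟨t, rfl⟩ := hι.filled b a h0' h'.le
  exact ⟨t, hι.mono.lt_iff_lt.1 h', rfl⟩

/-- The time axis has no gaps, so an edge value below `ι b` is itself a time before `b`, and `s`
represents all of these. -/
theorem edge_before_iff (hι : IsTimeAxis ι o) (hM : IsPairMatrix M w) {b s : T}
    (hs : IsLast ι M b s) {e : Sym2 V} (he : ¬ e.IsDiag) :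
    w e ≤ (ι s : EReal) ↔ w e < (ι b : EReal) := by
  classical
  constructor
  · intro h
    refine h.trans_lt ?_
    exact_mod_cast hι.mono (show s < b by exact_mod_cast hs.1)
  · intro h
    obtain ⟨t, ht, hw⟩ := hι.exists_lt (hM.pos e he).le h
    rw [← toFinset_mem_vietorisRips hM he (hι.nonneg s)]
    refine hs.2 t (by exact_mod_cast ht) _ ?_
    exact (toFinset_mem_vietorisRips hM he (hι.nonneg t)).2 hw.le

/-- The edges that appear at a given time are counted by the points of the `0`-th diagram that die
and the points of the `1`-st diagram that are born at that time. -/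
theorem ncard_edges_at [Fintype V] (hι : IsTimeAxis ι o) (hM : IsPairMatrix M w) {b : T} (hob : o < b) :
    {e : Sym2 V | ¬ e.IsDiag ∧ w e = (ι b : EReal)}.ncard =
      persistenceDiagram 0 (ripsFiltration ι M) o b +
        persistenceDiagram 1 (ripsFiltration ι M) b ⊤ := by
  obtain ⟨s, hs⟩ : ∃ s, IsLast ι M b s := exists_last hι M (by exact_mod_cast hob)
  have h0 := persistenceDiagram_zero_finite hι hM hob hs
  have h1 := persistenceDiagram_one_top hι hs
  -- Rank-nullity at `b` and just before `b`: the increase in the number of edges splits into the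
  -- increase in rank and the increase in cycles.
  have hb := finrank_boundaries_add_finrank_cycles (ripsFiltration ι M b)
  have hs' := finrank_boundaries_add_finrank_cycles (ripsFiltration ι M s)
  rw [ncard_edges hM (hι.nonneg _)] at hb hs'
  have hd : {e : Sym2 V | ¬ e.IsDiag ∧ w e ≤ (ι b : EReal)} =
      {e : Sym2 V | ¬ e.IsDiag ∧ w e = (ι b : EReal)} ∪
        {e : Sym2 V | ¬ e.IsDiag ∧ w e ≤ (ι s : EReal)} := by
    ext e
    simp only [Set.mem_ofPred_eq, Set.mem_union, ← and_or_left]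
    refine and_congr_right fun he => ?_
    rw [edge_before_iff hι hM hs he, le_iff_lt_or_eq, or_comm]
  rw [hd, Set.ncard_union_eq ?_ (Set.toFinite _) (Set.toFinite _)] at hb
  · omega
  · rw [Set.disjoint_left]
    rintro e ⟨he, h⟩ ⟨_, h'⟩
    rw [edge_before_iff hι hM hs he] at h'
    exact h'.ne h

/-- The rank at a time no later than the first edges. -/
theorem finrank_boundaries_of_forall_lt [Fintype V] (hι : IsTimeAxis ι o) (hM : IsPairMatrix M w) {s : T}
    (h : ∀ e : Sym2 V, ¬ e.IsDiag → (ι s : EReal) < w e) :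
    Module.finrank (ZMod 2) (boundaries 0 (ripsFiltration ι M s)) = 0 := by
  have h1 := finrank_boundaries_add_finrank_cycles (ripsFiltration ι M s)
  rw [ncard_edges hM (hι.nonneg _)] at h1
  have : {e : Sym2 V | ¬ e.IsDiag ∧ w e ≤ (ι s : EReal)} = ∅ := by
    ext e
    simp only [Set.mem_ofPred_eq, Set.mem_empty_iff_false, iff_false]
    exact fun he => absurd he.2 (h e he.1).not_ge
  rw [this, Set.ncard_empty] at h1
  omega

theorem persistenceDiagram_zero_first [Fintype V] (hι : IsTimeAxis ι o) (hM : IsPairMatrix M w) {b : T}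
    (hob : o < b) (h : ∀ e : Sym2 V, ¬ e.IsDiag → (ι b : EReal) ≤ w e) :
    persistenceDiagram 0 (ripsFiltration ι M) o b =
      Module.finrank (ZMod 2) (boundaries 0 (ripsFiltration ι M b)) := by
  obtain ⟨s, hs⟩ : ∃ s, IsLast ι M b s := exists_last hι M (by exact_mod_cast hob)
  rw [← persistenceDiagram_zero_finite hι hM hob hs, finrank_boundaries_of_forall_lt hι hM, add_zero]
  intro e he
  refine lt_of_lt_of_le ?_ (h e he)
  exact_mod_cast hι.mono (show s < b by exact_mod_cast hs.1)

end

/-! ### Comparison of two filtrations -/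

section

variable {V W : Type v} {T : Type*} [LinearOrder T] {ι : T → ℝ} {o : T}
  {M : V → V → EReal} {w : Sym2 V → EReal} {M' : W → W → EReal} {w' : Sym2 W → EReal}

/-- A time common to two filtrations that is representative for all times shortly before `d`. -/
theorem exists_last_last [Finite V] [Finite W] (hι : IsTimeAxis ι o) (M : V → V → EReal) (M' : W → W → EReal)
    {d : WithTop T} (hd : (o : WithTop T) < d) : ∃ s, IsLast ι M d s ∧ IsLast ι M' d s := by
  obtain ⟨s, hs⟩ := exists_last hι M hd
  obtain ⟨t, ht⟩ := exists_last hι M' hd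
  refine ⟨max s t, ⟨?_, fun r hr σ hσ => ?_⟩, ?_, fun r hr σ hσ => ?_⟩
  · rcases max_choice s t with h | h <;> rw [h]
    exacts [hs.1, ht.1]
  · exact vietorisRips_mono (hι.mono.monotone (le_max_left s t)) _ (hs.2 r hr σ hσ)
  · rcases max_choice s t with h | h <;> rw [h]
    exacts [hs.1, ht.1]
  · exact vietorisRips_mono (hι.mono.monotone (le_max_right s t)) _ (ht.2 r hr σ hσ)

theorem boundaries_congr (hι : IsTimeAxis ι o) (hM : IsPairMatrix M w) {s t : T}
    (h : ∀ e : Sym2 V, ¬ e.IsDiag → w e ≤ (ι s : EReal) → w e ≤ (ι t : EReal)) (hts : t ≤ s) :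
    boundaries 0 (ripsFiltration ι M s) = boundaries 0 (ripsFiltration ι M t) := by
  classical
  rw [boundaries, boundaries, chains, chains]
  congr 2
  ext σ
  refine ⟨fun hσ => ⟨?_, hσ.2⟩, fun hσ => ⟨?_, hσ.2⟩⟩
  · obtain ⟨h1, h2⟩ := hσ
    obtain ⟨x, y, hxy, rfl⟩ := Finset.card_eq_two.1 h2
    have hd : ¬ (s(x, y)).IsDiag := by simpa using hxy
    rw [← Sym2.toFinset_mk_eq] at h1 ⊢
    rw [toFinset_mem_vietorisRips hM hd (hι.nonneg _)] at h1 ⊢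
    exact h _ hd h1
  · exact vietorisRips_mono (hι.mono.monotone hts) _ hσ.1

/-- The ranks start at `0` and jump only at edge values, by amounts recorded in the `0`-th diagram.
The induction is on the number of edges present in the two filtrations together. -/
theorem finrank_boundaries_eq [Fintype V] [Fintype W] (hι : IsTimeAxis ι o) (hM : IsPairMatrix M w)
    (hM' : IsPairMatrix M' w')
    (h : persistenceDiagram 0 (ripsFiltration ι M) = persistenceDiagram 0 (ripsFiltration ι M'))
    (n : ℕ) : ∀ s : T, {e : Sym2 V | ¬ e.IsDiag ∧ w e ≤ (ι s : EReal)}.ncard +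
        {e : Sym2 W | ¬ e.IsDiag ∧ w' e ≤ (ι s : EReal)}.ncard = n →
      Module.finrank (ZMod 2) (boundaries 0 (ripsFiltration ι M s)) =
        Module.finrank (ZMod 2) (boundaries 0 (ripsFiltration ι M' s)) := by
  induction n using Nat.strong_induction_on with | _ n ih
  intro s hn
  let S : Set EReal := (w '' {e | ¬ e.IsDiag ∧ w e ≤ (ι s : EReal)}) ∪
    (w' '' {e | ¬ e.IsDiag ∧ w' e ≤ (ι s : EReal)})
  have hSfin : S.Finite := ((Set.toFinite _).image _).union ((Set.toFinite _).image _)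
  rcases S.eq_empty_or_nonempty with hS | hS
  · rw [finrank_boundaries_of_forall_lt hι hM, finrank_boundaries_of_forall_lt hι hM']
    · intro e he
      by_contra hlt
      exact (hS ▸ (Or.inr ⟨e, ⟨he, not_lt.1 hlt⟩, rfl⟩ : w' e ∈ S) : w' e ∈ (∅ : Set EReal))
    · intro e he
      by_contra hlt
      exact (hS ▸ (Or.inl ⟨e, ⟨he, not_lt.1 hlt⟩, rfl⟩ : w e ∈ S) : w e ∈ (∅ : Set EReal))
  -- The last value up to `s` at which either filtration gains an edge; both ranks are constant from
  -- there to `s`.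
  obtain ⟨r, hrS, hr⟩ := hSfin.exists_maximalFor id _ hS
  have hmax : ∀ a ∈ S, a ≤ r := fun a ha => (le_total a r).elim id fun h => hr ha h
  have hr0 : 0 < r ∧ r ≤ (ι s : EReal) := by
    rcases hrS with ⟨e, he, rfl⟩ | ⟨e, he, rfl⟩
    exacts [⟨hM.pos e he.1, he.2⟩, ⟨hM'.pos e he.1, he.2⟩]
  obtain ⟨t, hts, rfl⟩ : ∃ t ≤ s, r = (ι t : EReal) := by
    rcases hr0.2.lt_or_eq with hlt | heq
    · obtain ⟨t, ht, h⟩ := hι.exists_lt hr0.1.le hlt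
      exact ⟨t, ht.le, h⟩
    · exact ⟨s, le_rfl, heq⟩
  have hot : o < t := hι.mono.lt_iff_lt.1 (by rw [hι.zero]; exact_mod_cast hr0.1)
  rw [boundaries_congr hι hM (fun e he hs => hmax _ (Or.inl ⟨e, ⟨he, hs⟩, rfl⟩)) hts,
    boundaries_congr hι hM' (fun e he hs => hmax _ (Or.inr ⟨e, ⟨he, hs⟩, rfl⟩)) hts]
  obtain ⟨u, hu, hu'⟩ := exists_last_last hι M M' (show (o : WithTop T) < t by exact_mod_cast hot)
  rw [← persistenceDiagram_zero_finite hι hM hot hu, h,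
    ← persistenceDiagram_zero_finite hι hM' hot hu', ih _ ?_ u rfl]
  have hut : (ι u : EReal) < (ι t : EReal) := by
    exact_mod_cast hι.mono (show u < t by exact_mod_cast hu.1)
  have hus : (ι u : EReal) ≤ (ι s : EReal) := hut.le.trans hr0.2
  have sub : {e : Sym2 V | ¬ e.IsDiag ∧ w e ≤ (ι u : EReal)} ⊆
      {e : Sym2 V | ¬ e.IsDiag ∧ w e ≤ (ι s : EReal)} := fun e he => ⟨he.1, he.2.trans hus⟩
  have sub' : {e : Sym2 W | ¬ e.IsDiag ∧ w' e ≤ (ι u : EReal)} ⊆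
      {e : Sym2 W | ¬ e.IsDiag ∧ w' e ≤ (ι s : EReal)} := fun e he => ⟨he.1, he.2.trans hus⟩
  -- An edge of value exactly `ι t` is present at `s` but not at `u`, so the induction parameter
  -- drops.
  rw [← hn]
  rcases hrS with ⟨e, he, hw⟩ | ⟨e, he, hw⟩
  · refine add_lt_add_of_lt_of_le (Set.ncard_lt_ncard ⟨sub, fun hsub => ?_⟩ (Set.toFinite _))
      (Set.ncard_le_ncard sub' (Set.toFinite _))
    exact ((hsub he).2.trans_lt hut).ne hw
  · refine add_lt_add_of_le_of_lt (Set.ncard_le_ncard sub (Set.toFinite _))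
      (Set.ncard_lt_ncard ⟨sub', fun hsub => ?_⟩ (Set.toFinite _))
    exact ((hsub he).2.trans_lt hut).ne hw

/-- The `0`-th persistence diagram determines the number of points. -/
theorem card_eq_of_persistenceDiagram_zero [Fintype V] [Fintype W] (hι : IsTimeAxis ι o) (hM : IsPairMatrix M w)
    (hM' : IsPairMatrix M' w')
    (h : persistenceDiagram 0 (ripsFiltration ι M) = persistenceDiagram 0 (ripsFiltration ι M')) :
    Fintype.card V = Fintype.card W := by
  obtain ⟨s, hs, hs'⟩ := exists_last_last hι M M' (WithTop.coe_lt_top o)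
  rw [← persistenceDiagram_zero_top hι hM hs, ← persistenceDiagram_zero_top hι hM' hs', h,
    finrank_boundaries_eq hι hM hM' h _ s rfl]

end

/-! ### Ranks of connected and of disconnected graphs -/

section

variable {V : Type v} [Fintype V]

/-- Along a walk the boundaries of the edges telescope modulo `2` to the sum of the two ends. Hence
the boundaries together with one base vertex span all vertices. -/
theorem card_le_finrank_boundaries_add_one {g : SimpleGraph V} (hg : g.Connected)
    {K : PreAbstractSimplicialComplex V} [DecidableEq V]
    (h : ∀ x y, g.Adj x y → ({x, y} : Finset V) ∈ K) :
    Fintype.card V ≤ Module.finrank (ZMod 2) (boundaries 0 K) + 1 := by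
  obtain ⟨a⟩ := hg.nonempty
  have hB : ∀ x y, g.Reachable x y → (Finsupp.single {x} 1 + Finsupp.single {y} 1 : Chain V) ∈
      boundaries 0 K := by
    rintro x y ⟨p⟩
    induction p with
    | nil => rw [ZModModule.add_self]; exact zero_mem _
    | @cons x y z hxy p ih =>
      have h1 : (Finsupp.single {x} 1 + Finsupp.single {y} 1 : Chain V) ∈ boundaries 0 K :=
        ⟨_, Finsupp.single_mem_supported _ 1 ⟨h x y hxy, Finset.card_pair hxy.ne⟩,
          boundary_edge hxy.ne⟩
      have h2 := add_mem h1 ih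
      have h3 : (Finsupp.single {x} 1 + Finsupp.single {y} 1 +
          (Finsupp.single {y} 1 + Finsupp.single {z} 1) : Chain V) =
          Finsupp.single {x} 1 + (Finsupp.single {y} 1 + Finsupp.single {y} 1) +
            Finsupp.single {z} 1 := by abel
      rwa [h3, ZModModule.add_self, add_zero] at h2
  have hle : vertexChains V ≤ boundaries 0 K ⊔ Submodule.span (ZMod 2) {Finsupp.single {a} 1} := by
    rw [vertexChains, Finsupp.supported_eq_span_single, Submodule.span_le]
    rintro _ ⟨σ, hσ, rfl⟩
    obtain ⟨x, rfl⟩ := Finset.card_eq_one.1 hσ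
    have : (Finsupp.single {x} 1 : Chain V) =
        (Finsupp.single {x} 1 + Finsupp.single {a} 1) + Finsupp.single {a} 1 := by
      rw [add_assoc, ZModModule.add_self, add_zero]
    change (Finsupp.single {x} 1 : Chain V) ∈ _
    rw [this]
    exact add_mem (Submodule.mem_sup_left (hB _ _ (hg.preconnected x a)))
      (Submodule.mem_sup_right (Submodule.mem_span_singleton_self _))
  rw [← finrank_vertexChains]
  refine (Submodule.finrank_mono hle).trans ((Submodule.finrank_add_le_finrank_add_finrank _ _).trans
    (Nat.add_le_add_left ?_ _))
  exact (finrank_span_le_card _).trans (by simp)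

/-- The functional `x ↦ (1, f x)` kills the boundary of every edge, since `f` is constant on edges,
and maps the vertex chains onto a plane. So the boundaries have codimension at least `2`. -/
theorem finrank_boundaries_add_two_le {K : PreAbstractSimplicialComplex V} [DecidableEq V]
    (f : V → ZMod 2) (hf : ∀ x y, ({x, y} : Finset V) ∈ K → f x = f y) {a b : V}
    (ha : f a = 0) (hb : f b = 1) :
    Module.finrank (ZMod 2) (boundaries 0 K) + 2 ≤ Fintype.card V := by
  let ℓ : Chain V →ₗ[ZMod 2] ZMod 2 × ZMod 2 :=
    Finsupp.linearCombination (ZMod 2) fun σ => ∑ x ∈ σ, ((1 : ZMod 2), f x)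
  have hsing : ∀ x, ℓ (Finsupp.single {x} 1) = (1, f x) := fun x => by simp [ℓ]
  have hker : boundaries 0 K ≤ LinearMap.ker ℓ := by
    rw [boundaries, chains, Finsupp.supported_eq_span_single, Submodule.map_span,
      Submodule.span_le]
    rintro _ ⟨_, ⟨σ, hσ, rfl⟩, rfl⟩
    obtain ⟨x, y, hxy, rfl⟩ := Finset.card_eq_two.1 hσ.2
    rw [boundary_edge hxy, SetLike.mem_coe, LinearMap.mem_ker, map_add, hsing, hsing,
      hf x y hσ.1]
    exact ZModModule.add_self _
  have hmem : ∀ x, (Finsupp.single {x} 1 : Chain V) ∈ vertexChains V := fun x =>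
    Finsupp.single_mem_supported _ _ (by simp)
  have hmap : (vertexChains V).map ℓ = ⊤ := by
    rw [eq_top_iff]
    rintro ⟨p, q⟩ -
    refine ⟨(p - q) • Finsupp.single {a} 1 + q • Finsupp.single {b} 1,
      add_mem (Submodule.smul_mem _ _ (hmem a)) (Submodule.smul_mem _ _ (hmem b)), ?_⟩
    rw [map_add, map_smul, map_smul, hsing, hsing, ha, hb]
    simp
  have h := finrank_map_add_finrank_inf_ker ℓ (vertexChains V)
  rw [hmap, finrank_top, Module.finrank_prod, Module.finrank_self, finrank_vertexChains] at h
  have h2 := Submodule.finrank_mono (le_inf (boundaries_zero_le K) hker)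
  omega

end

/-! ### Edge colors and node colors -/

section

open Classical in
/-- The multiset of the colored edges of a colored graph. -/
noncomputable def edgeColorMultiset {V : Type v} [Fintype V] {α : Type*} (g : SimpleGraph V)
    (c : V → α) : Multiset (Sym2 α) :=
  g.edgeFinset.val.map (Sym2.map c)

open Classical in
/-- The number of endpoints of color `k` of a colored edge. -/
noncomputable def endpointCount {α : Type*} (k : α) : Sym2 α → ℕ :=
  Sym2.lift ⟨fun a b => (if a = k then 1 else 0) + (if b = k then 1 else 0),
    fun _ _ => add_comm _ _⟩

variable {V W : Type v} [Fintype V] [Fintype W] {α : Type*}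

open Classical in
-- Double counting of the incidences between edges and nodes of color `k`.
theorem sum_degree_eq (g : SimpleGraph V) (c : V → α) (k : α) :
    ∑ x with c x = k, g.degree x = ((edgeColorMultiset g c).map (endpointCount k)).sum := by
  rw [edgeColorMultiset, Multiset.map_map]
  change _ = ∑ e ∈ g.edgeFinset, endpointCount k (e.map c)
  have h1 : ∀ x, g.degree x = ∑ e ∈ g.edgeFinset, if x ∈ e then 1 else 0 := fun x => by
    rw [← SimpleGraph.card_incidenceFinset_eq_degree, SimpleGraph.incidenceFinset_eq_filter,
      Finset.card_filter]
  simp_rw [h1]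
  rw [Finset.sum_comm]
  refine Finset.sum_congr rfl fun e he => ?_
  induction e with | _ x y
  have hxy : x ≠ y := by
    rw [SimpleGraph.mem_edgeFinset, SimpleGraph.mem_edgeSet] at he
    exact he.ne
  have : ∀ z, (if z ∈ s(x, y) then 1 else 0 : ℕ) =
      (if z = x then 1 else 0) + (if z = y then 1 else 0) := by
    intro z
    by_cases h1 : z = x <;> by_cases h2 : z = y <;> simp_all
  simp_rw [this, Finset.sum_add_distrib]
  simp [endpointCount, Finset.sum_ite_eq']

open Classical in
theorem count_map_eq_of_degree (g : SimpleGraph V) (h : SimpleGraph W) (c : V → α) (c' : W → α)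
    (he : edgeColorMultiset g c = edgeColorMultiset h c') {k : α} {d : ℕ} (hd : 0 < d)
    (hg : ∀ x, c x = k → g.degree x = d) (hh : ∀ x, c' x = k → h.degree x = d) :
    (Finset.univ.val.map c).count k = (Finset.univ.val.map c').count k := by
  have key : ∀ {U : Type v} [Fintype U] (f : SimpleGraph U) (b : U → α),
      (∀ x, b x = k → f.degree x = d) → (Finset.univ.val.map b).count k * d =
        ((edgeColorMultiset f b).map (endpointCount k)).sum := by
    intro U _ f b hb
    rw [← sum_degree_eq, Finset.sum_congr rfl fun x hx => hb x (Finset.mem_filter.1 hx).2,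
      Finset.sum_const, smul_eq_mul, Multiset.count_map, Finset.card_def, Finset.filter_val]
    simp_rw [eq_comm (a := k)]
  have h1 := key g c hg
  rw [he, ← key h c' hh] at h1
  exact Nat.eq_of_mul_eq_mul_right hd h1

end

/-! ### From colored edges to node colors; stable WL colorings -/

section

variable {𝒢 : GraphSpace.{u, v}} {N : ℕ} {C : NodeColoring 𝒢 N}

open Classical in
theorem count_colorMultiset_eq (hC : DegreeAssumption C) {G H : 𝒢.Idx}
    (he : edgeColorMultiset (𝒢.graph G) (C G) = edgeColorMultiset (𝒢.graph H) (C H))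
    {k : Feature N} (hG : ∀ x, C G x = k → ∃ y, (𝒢.graph G).Adj x y)
    (hH : ∀ x, C H x = k → ∃ y, (𝒢.graph H).Adj x y) :
    (colorMultiset C G).count k = (colorMultiset C H).count k := by
  by_cases hx : ∃ x, C G x = k
  · obtain ⟨x, rfl⟩ := hx
    have hd : 0 < (𝒢.graph G).degree x := by
      rw [SimpleGraph.degree_pos_iff_exists_adj]
      exact hG x rfl
    convert count_map_eq_of_degree _ _ _ _ he hd
      (fun y hy => hC _ _ _ _ hy) (fun y hy => hC _ _ _ _ hy) <;> rfl
  by_cases hy : ∃ x, C H x = k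
  · obtain ⟨x, rfl⟩ := hy
    have hd : 0 < (𝒢.graph H).degree x := by
      rw [SimpleGraph.degree_pos_iff_exists_adj]
      exact hH x rfl
    convert count_map_eq_of_degree _ _ _ _ he hd
      (fun y hy => hC _ _ _ _ hy) (fun y hy => hC _ _ _ _ hy) <;> rfl
  · push Not at hx hy
    rw [Multiset.count_eq_zero_of_notMem, Multiset.count_eq_zero_of_notMem] <;>
      simp [colorMultiset, hx, hy]

theorem colorMultiset_eq_of_noIsolated (hC : DegreeAssumption C) {G H : 𝒢.Idx}
    (he : edgeColorMultiset (𝒢.graph G) (C G) = edgeColorMultiset (𝒢.graph H) (C H))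
    (hG : NoIsolated (𝒢.graph G)) (hH : NoIsolated (𝒢.graph H)) :
    colorMultiset C G = colorMultiset C H := by
  classical
  exact Multiset.ext.2 fun k => count_colorMultiset_eq hC he (fun x _ => hG x) fun x _ => hH x

/-- Two multisets of the same size are equal if the multiplicities agree outside one element. -/
theorem multiset_eq_of_count_eq {α : Type*} [DecidableEq α] {s t : Multiset α} (a : α)
    (hcard : s.card = t.card) (h : ∀ b ≠ a, s.count b = t.count b) : s = t := by
  have hf : s.filter (· ≠ a) = t.filter (· ≠ a) := by
    ext b
    by_cases hb : b = a
    · simp [hb]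
    · rw [Multiset.count_filter_of_pos (p := (· ≠ a)) hb,
        Multiset.count_filter_of_pos (p := (· ≠ a)) hb, h b hb]
  have key : ∀ r : Multiset α, r.card = (r.filter (· ≠ a)).card + r.count a := by
    intro r
    induction r using Multiset.induction_on with
    | empty => simp
    | cons b r ih =>
      by_cases hb : b = a
      · subst hb; simp [ih, add_assoc]
      · simp [hb, Ne.symm hb, ih]; omega
  have hs := key s
  have ht := key t
  rw [hf] at hs
  ext b
  by_cases hb : b = a
  · subst hb; omega
  · exact h b hb

/-- The first refinement round already records the number of neighbors. -/
theorem IsStableWL.degreeAssumption (hC : IsStableWL C) : DegreeAssumption C := by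
  intro G H x y hxy
  have h := (hC G H x y).1 hxy 1
  have h2 : Multiset.card _ = Multiset.card _ := congrArg (fun p => Multiset.card p.2) h
  exact (Multiset.card_map _ _).symm.trans (h2.trans (Multiset.card_map _ _))

theorem IsStableWL.eq_of_isolated (hC : IsStableWL C) {G H : 𝒢.Idx} {x : 𝒢.V G} {y : 𝒢.V H}
    (hx : ¬ ∃ z, (𝒢.graph G).Adj x z) (hy : ¬ ∃ z, (𝒢.graph H).Adj y z) : C G x = C H y := by
  classical
  rw [hC]
  intro t
  induction t with
  | zero => rfl
  | succ t ih =>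
    have e1 : (𝒢.graph G).neighborFinset x = ∅ := by
      ext z; simpa using fun h => hx ⟨z, h⟩
    have e2 : (𝒢.graph H).neighborFinset y = ∅ := by
      ext z; simpa using fun h => hy ⟨z, h⟩
    refine Prod.ext ih ?_
    change ((𝒢.graph G).neighborFinset x).val.map _ = ((𝒢.graph H).neighborFinset y).val.map _
    rw [e1, e2]
    rfl

theorem IsStableWL.colorMultiset_eq (hC : IsStableWL C) {G H : 𝒢.Idx}
    (he : edgeColorMultiset (𝒢.graph G) (C G) = edgeColorMultiset (𝒢.graph H) (C H))
    (hcard : Fintype.card (𝒢.V G) = Fintype.card (𝒢.V H)) :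
    colorMultiset C G = colorMultiset C H := by
  classical
  by_cases hiso : ∃ (J : 𝒢.Idx) (z : 𝒢.V J), ¬ ∃ z', (𝒢.graph J).Adj z z'
  · obtain ⟨J, z, hz⟩ := hiso
    -- The color of isolated nodes is the one exceptional color; nodes of any other color have
    -- positive degree.
    refine multiset_eq_of_count_eq (C J z) (by simpa [colorMultiset] using hcard) fun k hk => ?_
    refine count_colorMultiset_eq hC.degreeAssumption he ?_ ?_
    · rintro x rfl
      by_contra hx
      exact hk (hC.eq_of_isolated hx hz)
    · rintro x rfl
      by_contra hx
      exact hk (hC.eq_of_isolated hx hz)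
  · push Not at hiso
    exact colorMultiset_eq_of_noIsolated hC.degreeAssumption he (hiso G) (hiso H)

open Classical in
theorem wlColor_eq_of_regular {V W : Type v} [Fintype V] [Fintype W] {g : SimpleGraph V}
    {h : SimpleGraph W} {d : ℕ} (hg : ∀ x, g.degree x = d) (hh : ∀ x, h.degree x = d) (t : ℕ) :
    ∀ x y, wlColor g t x = wlColor h t y := by
  induction t with
  | zero => exact fun _ _ => rfl
  | succ t ih =>
    intro x y
    refine Prod.ext (ih x y) ?_
    change (g.neighborFinset x).val.map _ = (h.neighborFinset y).val.map _
    -- Both neighbor multisets are constant with the same value, so only their sizes matter.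
    rw [Multiset.map_congr rfl fun z _ => ih z y,
      Multiset.map_congr (rfl : (h.neighborFinset y).val = _) fun z _ => (ih x z).symm.trans (ih x y),
      Multiset.map_const', Multiset.map_const']
    congr 1
    exact (hg x).trans (hh y).symm

theorem colorMultiset_eq_of_const {G H : 𝒢.Idx} {k : Feature N}
    (hG : ∀ x, C G x = k) (hH : ∀ x, C H x = k)
    (hcard : Fintype.card (𝒢.V G) = Fintype.card (𝒢.V H)) :
    colorMultiset C G = colorMultiset C H := by
  simp [colorMultiset, hG, hH, hcard]

end

/-! ### Recovering edge values from the persistence diagrams -/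

section

variable {𝒢 : GraphSpace.{u, v}} {N : ℕ} {C : NodeColoring 𝒢 N} {ef : Sym2 (Feature N) → ℝ}

open Classical in
/-- The values of the matrix of the topological edge diagram on pairs. -/
noncomputable def tedValue (C : NodeColoring 𝒢 N) (ef : Sym2 (Feature N) → ℝ) (G : 𝒢.Idx)
    (e : Sym2 (𝒢.V G)) : EReal :=
  if e ∈ (𝒢.graph G).edgeSet then ((ef (e.map (C G)) : ℝ) : EReal) else ⊤

theorem isPairMatrix_ted (hef : IsInjectiveEdgeFiltration C ef) (G : 𝒢.Idx) :
    IsPairMatrix (tedMatrix C ef G) (tedValue C ef G) where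
  diag x := by simp [tedMatrix]
  offDiag x y hxy := by simp [tedMatrix, tedValue, hxy]; rfl
  pos e he := by
    induction e with | _ x y
    rw [tedValue]
    split_ifs with h
    · exact_mod_cast hef.pos _ ⟨G, x, y, h, rfl⟩
    · exact EReal.zero_lt_top

open Classical in
theorem count_edgeColorMultiset (hef : IsInjectiveEdgeFiltration C ef) (G : 𝒢.Idx)
    {k : Sym2 (Feature N)} (hk : k ∈ coloredEdges C) :
    (edgeColorMultiset (𝒢.graph G) (C G)).count k =
      {e | ¬ e.IsDiag ∧ tedValue C ef G e = (ef k : EReal)}.ncard := by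
  rw [edgeColorMultiset, Multiset.count_map, ← Finset.filter_val, Finset.card_val,
    ← Set.ncard_coe_finset]
  congr 1
  ext e
  simp only [Finset.coe_filter, SimpleGraph.mem_edgeFinset, Set.mem_ofPred_eq, tedValue]
  constructor
  · rintro ⟨he, rfl⟩
    exact ⟨(𝒢.graph G).not_isDiag_of_mem_edgeSet he, by rw [if_pos he]⟩
  · rintro ⟨-, h⟩
    split_ifs at h with he
    · refine ⟨he, hef.inj hk ?_ (by exact_mod_cast h.symm)⟩
      induction e with | _ x y
      exact ⟨G, x, y, he, rfl⟩
    · exact absurd h (EReal.coe_ne_top _).symm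

theorem edgeColorMultiset_eq_of_TED (hef : IsInjectiveEdgeFiltration C ef) {G H : 𝒢.Idx}
    (h : TED C ef G = TED C ef H) :
    edgeColorMultiset (𝒢.graph G) (C G) = edgeColorMultiset (𝒢.graph H) (C H) := by
  classical
  ext k
  by_cases hk : k ∈ coloredEdges C
  · have hpos := hef.pos k hk
    have hb : (0 : ℝ≥0) < ⟨ef k, hpos.le⟩ := hpos
    rw [count_edgeColorMultiset hef G hk, count_edgeColorMultiset hef H hk]
    have h1 := ncard_edges_at isTimeAxis_nnreal (isPairMatrix_ted hef G) hb
    have h2 := ncard_edges_at isTimeAxis_nnreal (isPairMatrix_ted hef H) hb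
    refine h1.trans (Eq.trans ?_ h2.symm)
    exact congrArg₂ (· + ·) (congrFun₂ (congrArg Prod.fst h) _ _)
      (congrFun (congrFun (congrArg Prod.snd h) ⟨ef k, hpos.le⟩) ⊤)
  · have : ∀ G : 𝒢.Idx, (edgeColorMultiset (𝒢.graph G) (C G)).count k = 0 := by
      intro G
      refine Multiset.count_eq_zero_of_notMem fun hmem => hk ?_
      obtain ⟨e, he, rfl⟩ := Multiset.mem_map.1 hmem
      induction e with | _ x y
      exact ⟨G, x, y, by simpa using he, rfl⟩
    rw [this, this]

theorem card_eq_of_TED (hef : IsInjectiveEdgeFiltration C ef) {G H : 𝒢.Idx}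
    (h : TED C ef G = TED C ef H) : Fintype.card (𝒢.V G) = Fintype.card (𝒢.V H) :=
  card_eq_of_persistenceDiagram_zero isTimeAxis_nnreal (isPairMatrix_ted hef G)
    (isPairMatrix_ted hef H) (congrArg Prod.fst h)

end

/-! ### Edge values of LGVR -/

section

variable {N : ℕ} (θ : LGVRWeights N) {V W : Type v} [Fintype V] [Fintype W]
  (g : SimpleGraph V) (c : V → Feature N) (h : SimpleGraph W) (c' : W → Feature N)

open Classical in
/-- The values of the edge filtration matrix on pairs. -/
noncomputable def lgvrValue (e : Sym2 V) : EReal :=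
  if he : e ∈ (⊤ : SimpleGraph V).edgeSet then ((edgeValue θ g c ⟨e, he⟩ : ℝ) : EReal) else 0

theorem isPairMatrix_lgvr :
    IsPairMatrix (fun x y => ((edgeMatrix θ g c x y : ℝ) : EReal)) (lgvrValue θ g c) where
  diag x := by simp [edgeMatrix]
  offDiag x y hxy := by simp [edgeMatrix, lgvrValue, hxy]
  pos e he := by
    have : e ∈ (⊤ : SimpleGraph V).edgeSet := by simpa using he
    rw [lgvrValue, dif_pos this]
    exact_mod_cast Real.sigmoid_pos _

open Classical in
/-- The multiset of all values of the edge filtration. -/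
noncomputable def edgeValueMultiset : Multiset ℝ :=
  (Finset.univ : Finset (⊤ : SimpleGraph V).edgeSet).val.map (edgeValue θ g c)

open Classical in
theorem count_edgeValueMultiset (r : ℝ) : (edgeValueMultiset θ g c).count r =
    {e | ¬ e.IsDiag ∧ lgvrValue θ g c e = (r : EReal)}.ncard := by
  rw [edgeValueMultiset, Multiset.count_map, ← Finset.filter_val, Finset.card_val,
    ← Set.ncard_coe_finset]
  refine Set.ncard_congr (fun e _ => (e : Sym2 V)) ?_ (fun _ _ _ _ => Subtype.ext) ?_
  · rintro ⟨e, he⟩ hr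
    simp only [Finset.coe_filter, Finset.mem_univ, true_and, Set.mem_ofPred_eq] at hr ⊢
    refine ⟨SimpleGraph.not_isDiag_of_mem_edgeSet _ he, ?_⟩
    rw [lgvrValue, dif_pos he, hr]
  · rintro e ⟨he, hr⟩
    have he' : e ∈ (⊤ : SimpleGraph V).edgeSet := by simpa using he
    refine ⟨⟨e, he'⟩, ?_, rfl⟩
    rw [lgvrValue, dif_pos he'] at hr
    simpa using (EReal.coe_injective hr).symm

variable {θ g c h c'}

theorem edgeValueMultiset_eq_of_LGVR (hle : ∀ e, edgeValue θ g c e ≤ 1 / 2)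
    (hle' : ∀ e, edgeValue θ h c' e ≤ 1 / 2) (hLG : LGVR θ g c = LGVR θ h c') :
    edgeValueMultiset θ g c = edgeValueMultiset θ h c' := by
  classical
  ext r
  by_cases hr : 0 < r ∧ r ≤ 1 / 2
  · have hb : (⟨0, by norm_num⟩ : Set.Icc (0 : ℝ) (1 / 2)) < ⟨r, hr.1.le, hr.2⟩ := hr.1
    rw [count_edgeValueMultiset, count_edgeValueMultiset]
    have h1 := ncard_edges_at isTimeAxis_Icc (isPairMatrix_lgvr θ g c) hb
    have h2 := ncard_edges_at isTimeAxis_Icc (isPairMatrix_lgvr θ h c') hb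
    refine h1.trans (Eq.trans ?_ h2.symm)
    exact congrArg₂ (· + ·) (congrFun₂ (congrArg Prod.fst hLG) _ _)
      (congrFun (congrFun (congrArg Prod.snd hLG) ⟨r, hr.1.le, hr.2⟩) ⊤)
  · rw [Multiset.count_eq_zero_of_notMem, Multiset.count_eq_zero_of_notMem]
    · intro hmem
      obtain ⟨e, -, rfl⟩ := Multiset.mem_map.1 hmem
      exact hr ⟨Real.sigmoid_pos _, hle' e⟩
    · intro hmem
      obtain ⟨e, -, rfl⟩ := Multiset.mem_map.1 hmem
      exact hr ⟨Real.sigmoid_pos _, hle e⟩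

theorem card_eq_of_LGVR (hLG : LGVR θ g c = LGVR θ h c') : Fintype.card V = Fintype.card W :=
  card_eq_of_persistenceDiagram_zero isTimeAxis_Icc (isPairMatrix_lgvr θ g c)
    (isPairMatrix_lgvr θ h c') (congrArg Prod.fst hLG)

open Classical in
/-- The function `D` reads off the color of an edge from its value in the filtration, and recognizes
the values of the nonadjacent pairs. -/
def IsDecoder (θ : LGVRWeights N) (D : ℝ → Option (Sym2 (Feature N))) {V : Type v} [Fintype V]
    (g : SimpleGraph V) (c : V → Feature N) : Prop :=
  ∀ e, D (edgeValue θ g c e) =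
    if (e : Sym2 V) ∈ g.edgeSet then some ((e : Sym2 V).map c) else none

theorem filterMap_edgeValueMultiset {D : ℝ → Option (Sym2 (Feature N))} (hD : IsDecoder θ D g c) :
    (edgeValueMultiset θ g c).filterMap D = edgeColorMultiset g c := by
  classical
  rw [edgeValueMultiset, Multiset.filterMap_map, edgeColorMultiset]
  have h1 : (Finset.univ : Finset (⊤ : SimpleGraph V).edgeSet).val.map Subtype.val =
      (⊤ : SimpleGraph V).edgeFinset.val := by
    rw [SimpleGraph.edgeFinset, Set.toFinset]
    rfl
  have h2 : (D ∘ edgeValue θ g c) =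
      (fun e : Sym2 V => if e ∈ g.edgeSet then some (e.map c) else none) ∘ Subtype.val :=
    funext hD
  rw [h2, ← Multiset.filterMap_map, h1]
  have h3 : g.edgeFinset.val = (⊤ : SimpleGraph V).edgeFinset.val.filter (· ∈ g.edgeSet) := by
    rw [← Finset.filter_val]
    congr 1
    ext e
    simp only [SimpleGraph.mem_edgeFinset, Finset.mem_filter]
    exact ⟨fun he => ⟨SimpleGraph.edgeSet_mono le_top he, he⟩, fun he => he.2⟩
  rw [h3, ← Multiset.filterMap_eq_filter, ← Multiset.filterMap_eq_map,
    Multiset.filterMap_filterMap]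
  congr 1
  funext e
  by_cases he : e ∈ g.edgeSet <;> simp [he, Option.guard]

theorem edgeColorMultiset_eq_of_LGVR {D : ℝ → Option (Sym2 (Feature N))}
    (hle : ∀ e, edgeValue θ g c e ≤ 1 / 2) (hle' : ∀ e, edgeValue θ h c' e ≤ 1 / 2)
    (hD : IsDecoder θ D g c) (hD' : IsDecoder θ D h c') (hLG : LGVR θ g c = LGVR θ h c') :
    edgeColorMultiset g c = edgeColorMultiset h c' := by
  rw [← filterMap_edgeValueMultiset hD, ← filterMap_edgeValueMultiset hD',
    edgeValueMultiset_eq_of_LGVR hle hle' hLG]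

end

/-! ### Generic parameters -/

/-- Neighbor sums in arbitrary finite graphs lie in such a closure, which keeps the inputs of every
layer countable. -/
theorem countable_addSubmonoid_closure {E : Type*} [AddMonoid E] {Z : Set E} (hZ : Z.Countable) :
    (AddSubmonoid.closure Z : Set E).Countable := by
  have := hZ.to_subtype
  refine (Set.countable_range fun l : List Z => (l.map Subtype.val).sum).mono fun x hx => ?_
  obtain ⟨l, hl, rfl⟩ := AddSubmonoid.exists_list_of_mem_closure hx
  lift l to List Z using hl
  exact ⟨l, rfl⟩

/-- For `z ≠ z'` and given `s`, `s'` at most one `ε` produces a collision, and the complement of a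
countable set is dense. -/
theorem exists_separating_scalar {E : Type*} [AddCommGroup E] [Module ℝ E] {Z S : Set E}
    (hZ : Z.Countable) (hS : S.Countable) :
    ∃ ε : ℝ, 1 < ε ∧ ∀ z ∈ Z, ∀ z' ∈ Z, ∀ s ∈ S, ∀ s' ∈ S,
      (1 + ε) • z + s = (1 + ε) • z' + s' → z = z' := by
  let B : Set ℝ := ⋃ p ∈ (Z ×ˢ Z) ×ˢ (S ×ˢ S), {ε | p.1.1 ≠ p.1.2 ∧
    (1 + ε) • p.1.1 + p.2.1 = (1 + ε) • p.1.2 + p.2.2}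
  have hB : B.Countable := by
    refine ((hZ.prod hZ).prod (hS.prod hS)).biUnion fun p _ => Set.Subsingleton.countable ?_
    rintro a ⟨hne, ha⟩ b ⟨-, hb⟩
    have h1 : (a - b) • (p.1.1 - p.1.2) = 0 := by
      have : (a - b) • (p.1.1 - p.1.2) = ((1 + a) • p.1.1 + p.2.1) - ((1 + a) • p.1.2 + p.2.2)
        - (((1 + b) • p.1.1 + p.2.1) - ((1 + b) • p.1.2 + p.2.2)) := by module
      rw [this, ha, hb, sub_self, sub_self, sub_self]
    rcases smul_eq_zero.1 h1 with h | h
    · exact sub_eq_zero.1 h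
    · exact absurd (sub_eq_zero.1 h) hne
  obtain ⟨ε, hε, hεB⟩ := (hB.dense_compl ℝ).inter_open_nonempty (Set.Ioi 1) isOpen_Ioi
    Set.nonempty_Ioi
  refine ⟨ε, hε, fun z hz z' hz' s hs s' hs' h => ?_⟩
  by_contra hne
  exact hεB (Set.mem_biUnion (x := ((z, z'), (s, s'))) ⟨⟨hz, hz'⟩, hs, hs'⟩ ⟨hne, h⟩)

/-- The vector of powers of `t` works as soon as `t` avoids the roots of the countably many nonzero
polynomials whose coefficients are differences of elements of `Y`. -/
theorem exists_separating_functional {m : ℕ} {Y : Set (Fin m → ℝ)} (hY : Y.Countable) :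
    ∃ w : Fin m → ℝ, Set.InjOn (fun y => w ⬝ᵥ y) Y := by
  let P : (Fin m → ℝ) → Polynomial ℝ := fun d =>
    ∑ i, Polynomial.C (d i) * Polynomial.X ^ (i : ℕ)
  have hcoeff : ∀ d i, (P d).coeff (i : Fin m) = d i := fun d i => by
    simp [P, Polynomial.coeff_C_mul, Polynomial.coeff_X_pow,
      Fin.val_inj]
  let B : Set ℝ := ⋃ p ∈ Y ×ˢ Y, {t | t ∈ (P (p.1 - p.2)).roots}
  have hB : B.Countable := (hY.prod hY).biUnion fun p _ =>
    (Multiset.finite_toSet _).countable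
  obtain ⟨t, ht⟩ := (hB.dense_compl ℝ).nonempty
  refine ⟨fun i => t ^ (i : ℕ), fun y hy y' hy' h => ?_⟩
  by_contra hne
  refine ht (Set.mem_biUnion (x := (y, y')) ⟨hy, hy'⟩ ?_)
  change t ∈ (P (y - y')).roots
  rw [Polynomial.mem_roots]
  · have : (P (y - y')).eval t = (fun i : Fin m => t ^ (i : ℕ)) ⬝ᵥ (y - y') := by
      simp only [P, Polynomial.eval_finsetSum, Polynomial.eval_mul, Polynomial.eval_C,
        Polynomial.eval_pow, Polynomial.eval_X, dotProduct]
      exact Finset.sum_congr rfl fun i _ => mul_comm _ _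
    rw [Polynomial.IsRoot, this, dotProduct_sub, sub_eq_zero]
    exact h
  · intro h0
    refine hne (funext fun i => ?_)
    have := hcoeff (y - y') i
    rw [h0, Polynomial.coeff_zero, Pi.sub_apply] at this
    exact (sub_eq_zero.1 this.symm)

/-- With this bias `|y + b|` is injective on `Y` and, by the case `y = y'`, never `0`. -/
theorem exists_separating_bias {Y : Set ℝ} (hY : Y.Countable) :
    ∃ b : ℝ, ∀ y ∈ Y, ∀ y' ∈ Y, y + b ≠ -(y' + b) := by
  let B : Set ℝ := (fun p : ℝ × ℝ => -(p.1 + p.2) / 2) '' (Y ×ˢ Y)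
  have hB : B.Countable := (hY.prod hY).image _
  obtain ⟨b, hb⟩ := (hB.dense_compl ℝ).nonempty
  refine ⟨b, fun y hy y' hy' h => hb ⟨(y, y'), ⟨hy, hy'⟩, ?_⟩⟩
  change -(y + y') / 2 = b
  linarith

/-! ### Multi-layer perceptrons for some simple maps -/

/-- A perceptron that computes a given linear map. -/
noncomputable def linearMLP {m n : ℕ} (A : Matrix (Fin n) (Fin m) ℝ) : MLP m n :=
  .shallow (k := n + n) (fun l => Fin.addCases (fun i => A i) (fun i => -A i) l) 0
    (fun j l => Fin.addCases (fun i => if i = j then 1 else 0)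
      (fun i => if i = j then -1 else 0) l) 0

theorem linearMLP_eval {m n : ℕ} (A : Matrix (Fin n) (Fin m) ℝ) (x : Fin m → ℝ) :
    (linearMLP A).eval x = A.mulVec x := by
  funext j
  simp only [linearMLP, MLP.eval, affine, relu, add_zero, Matrix.mulVec, dotProduct,
    Fin.sum_univ_add, Fin.addCases_left, Fin.addCases_right, ite_mul, zero_mul, one_mul,
    Finset.sum_ite_eq', Finset.mem_univ, if_true, neg_mul, Pi.neg_apply,
    Finset.sum_neg_distrib]
  rw [← sub_eq_add_neg]
  exact max_zero_sub_max_neg_zero_eq_self _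

/-- A perceptron that computes the absolute value of an affine function. -/
noncomputable def absMLP {m : ℕ} (w : Fin m → ℝ) (b : ℝ) : MLP m 1 :=
  .shallow (k := 2) ![w, -w] ![b, -b] ![![1, 1]] 0

theorem absMLP_eval {m : ℕ} (w : Fin m → ℝ) (b : ℝ) (x : Fin m → ℝ) :
    (absMLP w b).eval x 0 = |w ⬝ᵥ x + b| := by
  have h : (absMLP w b).eval x 0 = ∑ i : Fin 2, (![1, 1] : Fin 2 → ℝ) i *
      (![max (w ⬝ᵥ x + b) 0, max (-w ⬝ᵥ x + -b) 0] : Fin 2 → ℝ) i + 0 := by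
    have h' : (absMLP w b).eval x 0 = ∑ i : Fin 2, (![1, 1] : Fin 2 → ℝ) i *
      relu (affine ![w, -w] ![b, -b] x) i + 0 := rfl
    rw [h']
    refine congrArg (· + (0 : ℝ)) (Finset.sum_congr rfl fun i _ => ?_)
    fin_cases i <;> rfl
  rw [h, Fin.sum_univ_two]
  simp only [Matrix.cons_val_zero, Matrix.cons_val_one, one_mul, add_zero]
  rw [neg_dotProduct, ← neg_add, max_zero_add_max_neg_zero_eq_abs_self]

/-- A perceptron that computes the negative of the rectified linear unit. -/
noncomputable def negReluMLP : MLP 1 1 :=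
  .shallow (k := 1) 1 0 (-1) 0

theorem negReluMLP_eval (x : Fin 1 → ℝ) : negReluMLP.eval x 0 = -max (x 0) 0 := by
  simp [negReluMLP, MLP.eval, affine, relu, Matrix.neg_mulVec]

open Classical in
theorem ginLayer_negReluMLP {E : Type v} [Fintype E] (g : SimpleGraph E) (ε : ℝ)
    (X : E → Fin 1 → ℝ) (e : E) : ginLayer ε negReluMLP g X e 0 =
      -max ((1 + ε) • X e 0 + ∑ f ∈ g.neighborFinset e, X f 0) 0 := by
  rw [ginLayer, negReluMLP_eval, Pi.add_apply, Pi.smul_apply, Finset.sum_apply]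

/-! ### The weights -/

/-- Weights for which every layer of the network is a separating map, for suitable parameters. -/
noncomputable def separatingWeights {N : ℕ} (w₀ : Fin N → ℝ) (ε₁ : ℝ) (w : Fin (N + N) → ℝ)
    (b ε₂ : ℝ) : LGVRWeights N where
  mlp := linearMLP (Matrix.of (fun _ => w₀) - 1)
  η := 1
  d := 1
  P₁ := .last ε₁ (absMLP w b)
  P₂ := .last ε₂ negReluMLP

section

variable {N : ℕ} {w₀ : Fin N → ℝ} {ε₁ : ℝ} {w : Fin (N + N) → ℝ} {b ε₂ : ℝ}

/-- The perceptron subtracts the identity, which cancels the residual term `x` at `η = 1`. -/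
theorem shifted_separatingWeights (x : Feature N) (i : Fin N) :
    shifted (separatingWeights w₀ ε₁ w b ε₂) x i = w₀ ⬝ᵥ x := by
  simp only [shifted, separatingWeights, linearMLP_eval, one_smul, Matrix.sub_mulVec,
    Matrix.one_mulVec, Pi.add_apply, Pi.sub_apply]
  rw [add_sub_cancel]
  rfl

/-- The pairs of elements of a set. -/
def pairsOf {α : Type*} (χ : Set α) : Set (Sym2 α) := {e | ∀ x ∈ e, x ∈ χ}

theorem countable_pairsOf {α : Type*} {χ : Set α} (hχ : χ.Countable) : (pairsOf χ).Countable := by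
  refine ((hχ.prod hχ).image fun p => s(p.1, p.2)).mono fun e he => ?_
  induction e with | _ x y
  exact ⟨(x, y), ⟨he x (by simp), he y (by simp)⟩, rfl⟩

/-- Every coordinate of `x'` is `w₀ ⬝ᵥ x`, and two reals are determined up to order by their sum and
the absolute value of their difference. -/
theorem injOn_phi {χ : Set (Feature N)} (hw : Set.InjOn (fun y => w₀ ⬝ᵥ y) χ) :
    Set.InjOn (phi (separatingWeights w₀ ε₁ w b ε₂)) (pairsOf χ) := by
  rcases Nat.eq_zero_or_pos N with rfl | hN
  · exact fun e _ f _ _ => Subsingleton.elim e f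
  intro e he f hf h
  induction e with | _ x y
  induction f with | _ x' y'
  have h1 := congrFun h (Fin.castAdd N ⟨0, hN⟩)
  have h2 := congrFun h (Fin.natAdd N ⟨0, hN⟩)
  simp only [phi, Sym2.lift_mk, Fin.append_left, Fin.append_right, Pi.add_apply,
    shifted_separatingWeights] at h1 h2
  have hx := he x (by simp)
  have hy := he y (by simp)
  have hx' := hf x' (by simp)
  have hy' := hf y' (by simp)
  rcases abs_eq_abs.1 h2 with h2 | h2
  · rw [hw hx hx' (show w₀ ⬝ᵥ x = w₀ ⬝ᵥ x' by linarith),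
      hw hy hy' (show w₀ ⬝ᵥ y = w₀ ⬝ᵥ y' by linarith)]
  · rw [hw hx hy' (show w₀ ⬝ᵥ x = w₀ ⬝ᵥ y' by linarith),
      hw hy hx' (show w₀ ⬝ᵥ y = w₀ ⬝ᵥ x' by linarith), Sym2.eq_swap]

variable {V : Type v} [Fintype V] (g : SimpleGraph V) (c : V → Feature N)

open Classical in
theorem lineFeatures_separatingWeights (e : g.edgeSet) :
    lineFeatures (separatingWeights w₀ ε₁ w b ε₂) g c e (0 : Fin 1) =
      |w ⬝ᵥ ((1 + ε₁) • phi (separatingWeights w₀ ε₁ w b ε₂) ((e : Sym2 V).map c) +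
        ∑ f ∈ g.lineGraph.neighborFinset e,
          phi (separatingWeights w₀ ε₁ w b ε₂) ((f : Sym2 V).map c)) + b| := by
  simp only [lineFeatures]
  exact absMLP_eval _ _ _

open Classical in
/-- The scalar feature of a pair of nodes before the last network is applied. -/
noncomputable def pairFeature (w₀ : Fin N → ℝ) (ε₁ : ℝ) (w : Fin (N + N) → ℝ) (b ε₂ : ℝ)
    (g : SimpleGraph V) (c : V → Feature N) (e : (⊤ : SimpleGraph V).edgeSet) : ℝ :=
  if h : (e : Sym2 V) ∈ g.edgeSet then
    lineFeatures (separatingWeights w₀ ε₁ w b ε₂) g c ⟨e, h⟩ (0 : Fin 1) else 0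

theorem pairFeature_nonneg (e : (⊤ : SimpleGraph V).edgeSet) :
    0 ≤ pairFeature w₀ ε₁ w b ε₂ g c e := by
  rw [pairFeature]
  split_ifs with h
  · rw [lineFeatures_separatingWeights]
    exact abs_nonneg _
  · exact le_rfl

open Classical in
-- All pair features are nonnegative, so the ReLU acts as the identity and no information is lost.
theorem edgeValue_separatingWeights (hε₂ : 1 < ε₂) (e : (⊤ : SimpleGraph V).edgeSet) :
    edgeValue (separatingWeights w₀ ε₁ w b ε₂) g c e =
      Real.sigmoid (-((1 + ε₂) • pairFeature w₀ ε₁ w b ε₂ g c e +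
        ∑ f ∈ (⊤ : SimpleGraph V).lineGraph.neighborFinset e,
          pairFeature w₀ ε₁ w b ε₂ g c f)) := by
  have h2 : ∀ f, extendedFeatures (separatingWeights w₀ ε₁ w b ε₂) g c f (0 : Fin 1) =
      pairFeature w₀ ε₁ w b ε₂ g c f := by
    intro f
    rw [extendedFeatures, pairFeature]
    split_ifs <;> rfl
  refine congrArg Real.sigmoid ((ginLayer_negReluMLP _ _ _ _).trans ?_)
  simp only [h2]
  rw [max_eq_left]
  have := pairFeature_nonneg (w₀ := w₀) (ε₁ := ε₁) (w := w) (b := b) (ε₂ := ε₂) g c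
  exact add_nonneg (smul_nonneg (by linarith) (this e)) (Finset.sum_nonneg fun f _ => this f)

theorem edgeValue_le_half (hε₂ : 1 < ε₂) (e : (⊤ : SimpleGraph V).edgeSet) :
    edgeValue (separatingWeights w₀ ε₁ w b ε₂) g c e ≤ 1 / 2 := by
  rw [edgeValue_separatingWeights g c hε₂, one_div, ← Real.sigmoid_zero, Real.sigmoid_le_iff,
    Left.neg_nonpos_iff]
  have := pairFeature_nonneg (w₀ := w₀) (ε₁ := ε₁) (w := w) (b := b) (ε₂ := ε₂) g c
  exact add_nonneg (smul_nonneg (by linarith) (this e)) (Finset.sum_nonneg fun f _ => this f)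

end

/-! ### Regular graphs with constant coloring -/

section

variable {V : Type v} [Fintype V] {g : SimpleGraph V}

open Classical in
/-- The edges of a graph that are different from a given pair but meet it. -/
noncomputable def meetingEdges (g : SimpleGraph V) (e : Sym2 V) : Finset (Sym2 V) :=
  {f ∈ g.edgeFinset | e ≠ f ∧ ((e : Set V) ∩ (f : Set V)).Nonempty}

open Classical in
theorem meetingEdges_mk (x y : V) : meetingEdges g s(x, y) =
    (g.incidenceFinset x ∪ g.incidenceFinset y).erase s(x, y) := by
  ext f
  simp only [meetingEdges, Finset.mem_filter, SimpleGraph.mem_edgeFinset, Finset.mem_erase,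
    Finset.mem_union, SimpleGraph.mem_incidenceFinset, SimpleGraph.incidenceSet,
    Set.Nonempty, Set.mem_inter_iff, SetLike.mem_coe, Sym2.mem_iff, Set.mem_ofPred_eq]
  constructor
  · rintro ⟨hf, hne, z, rfl | rfl, hz⟩
    exacts [⟨hne.symm, Or.inl ⟨hf, hz⟩⟩, ⟨hne.symm, Or.inr ⟨hf, hz⟩⟩]
  · rintro ⟨hne, ⟨hf, hz⟩ | ⟨hf, hz⟩⟩
    exacts [⟨hf, hne.symm, x, Or.inl rfl, hz⟩, ⟨hf, hne.symm, y, Or.inr rfl, hz⟩]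

open Classical in
theorem card_meetingEdges_of_mem {d : ℕ} (hd : ∀ x, g.degree x = d) {e : Sym2 V}
    (he : e ∈ g.edgeSet) : (meetingEdges g e).card + 2 = 2 * d := by
  induction e with | _ x y
  have hadj : g.Adj x y := he
  have hinter : g.incidenceFinset x ∩ g.incidenceFinset y = {s(x, y)} := by
    rw [← Finset.coe_inj]
    simpa using g.incidenceSet_inter_incidenceSet_of_adj hadj
  have h1 := Finset.card_union_add_card_inter (g.incidenceFinset x) (g.incidenceFinset y)
  rw [hinter, Finset.card_singleton, SimpleGraph.card_incidenceFinset_eq_degree,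
    SimpleGraph.card_incidenceFinset_eq_degree, hd, hd] at h1
  have hmem : s(x, y) ∈ g.incidenceFinset x ∪ g.incidenceFinset y := by
    refine Finset.mem_union_left _ ?_
    rw [SimpleGraph.mem_incidenceFinset]
    exact ⟨he, Sym2.mem_mk_left x y⟩
  rw [meetingEdges_mk]
  have h2 := Finset.card_erase_add_one hmem
  omega

open Classical in
theorem card_meetingEdges_le {d : ℕ} (hd : ∀ x, g.degree x = d) (e : Sym2 V) :
    (meetingEdges g e).card ≤ 2 * d := by
  induction e with | _ x y
  rw [meetingEdges_mk]
  refine (Finset.card_erase_le).trans ((Finset.card_union_le _ _).trans ?_)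
  rw [SimpleGraph.card_incidenceFinset_eq_degree,
    SimpleGraph.card_incidenceFinset_eq_degree, hd, hd, two_mul]

open Classical in
-- Serves both networks: with `h = g` for the line graph of `g`, and with `h = ⊤` for the line graph
-- of the complete graph.
theorem sum_lineGraph_neighborFinset {E : Type*} [AddCommMonoid E] (h : SimpleGraph V)
    (hgh : g ≤ h) (e : h.edgeSet) [Fintype (h.lineGraph.neighborSet e)] (a : E) :
    ∑ f ∈ h.lineGraph.neighborFinset e, (if (f : Sym2 V) ∈ g.edgeSet then a else 0) =
      (meetingEdges g e).card • a := by
  rw [← Finset.sum_filter, Finset.sum_const]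
  congr 1
  refine Finset.card_bij (fun f _ => (f : Sym2 V)) ?_ (fun _ _ _ _ => Subtype.ext) ?_
  · rintro f hf
    rw [Finset.mem_filter, SimpleGraph.mem_neighborFinset, SimpleGraph.lineGraph_adj_iff_exists] at hf
    obtain ⟨⟨hne, z, hz⟩, hfg⟩ := hf
    rw [meetingEdges, Finset.mem_filter, SimpleGraph.mem_edgeFinset]
    exact ⟨hfg, fun h => hne (Subtype.ext h), z, hz⟩
  · rintro f hf
    rw [meetingEdges, Finset.mem_filter, SimpleGraph.mem_edgeFinset] at hf
    obtain ⟨hfg, hne, z, hz⟩ := hf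
    refine ⟨⟨f, SimpleGraph.edgeSet_mono hgh hfg⟩, ?_, rfl⟩
    rw [Finset.mem_filter, SimpleGraph.mem_neighborFinset, SimpleGraph.lineGraph_adj_iff_exists]
    exact ⟨⟨fun h => hne (congrArg Subtype.val h), z, hz⟩, hfg⟩

variable {N : ℕ} {w₀ : Fin N → ℝ} {ε₁ : ℝ} {w : Fin (N + N) → ℝ} {b ε₂ : ℝ}

open Classical in
/-- In a `2`-regular graph with constant coloring, all edges have the same value, which is smaller
than the values of the nonadjacent pairs. -/
theorem edgeValue_of_regular (hε₂ : 1 < ε₂) (k : Feature N) {z : ℝ} (hz0 : 0 < z)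
    (hz : z = |w ⬝ᵥ ((1 + ε₁) • phi (separatingWeights w₀ ε₁ w b ε₂) s(k, k) +
      2 • phi (separatingWeights w₀ ε₁ w b ε₂) s(k, k)) + b|)
    (hd : ∀ x, g.degree x = 2) (e : (⊤ : SimpleGraph V).edgeSet) :
    ((e : Sym2 V) ∈ g.edgeSet → edgeValue (separatingWeights w₀ ε₁ w b ε₂) g (fun _ => k) e =
      Real.sigmoid (-((1 + ε₂) * z + 2 * z))) ∧
    ((e : Sym2 V) ∉ g.edgeSet → Real.sigmoid (-((1 + ε₂) * z + 2 * z)) <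
      edgeValue (separatingWeights w₀ ε₁ w b ε₂) g (fun _ => k) e) := by
  have hmap : ∀ f : Sym2 V, f.map (fun _ => k) = s(k, k) := fun f => by
    induction f with | _ x y
    rfl
  have hline : ∀ f : g.edgeSet,
      lineFeatures (separatingWeights w₀ ε₁ w b ε₂) g (fun _ => k) f (0 : Fin 1) = z := by
    intro f
    rw [lineFeatures_separatingWeights, hz]
    simp only [hmap]
    have h1 := sum_lineGraph_neighborFinset g le_rfl f
      (phi (separatingWeights w₀ ε₁ w b ε₂) s(k, k))
    simp only [Subtype.coe_prop, if_true] at h1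
    have h2 := card_meetingEdges_of_mem hd f.2
    rw [h1, show (meetingEdges g f).card = 2 by omega]
  have hpair : ∀ f, pairFeature w₀ ε₁ w b ε₂ g (fun _ => k) f =
      if (f : Sym2 V) ∈ g.edgeSet then z else 0 := by
    intro f
    rw [pairFeature]
    split_ifs with h
    · exact hline _
    · rfl
  rw [edgeValue_separatingWeights g _ hε₂]
  simp only [hpair]
  rw [sum_lineGraph_neighborFinset (g := g) ⊤ le_top e z]
  constructor
  · intro he
    have h2 := card_meetingEdges_of_mem hd he
    rw [if_pos he, show (meetingEdges g e).card = 2 by omega]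
    simp
  · intro he
    have h2 : ((meetingEdges g e).card : ℝ) ≤ 4 := by
      exact_mod_cast card_meetingEdges_le hd (e : Sym2 V)
    rw [if_neg he, Real.sigmoid_lt_iff, smul_zero, zero_add, nsmul_eq_mul]
    -- A nonadjacent pair collects at most `4 * z`, an edge `(3 + ε₂) * z`; the condition `1 < ε₂`
    -- makes the latter larger.
    nlinarith

end

/-! ### Existence of the weights -/

/-- The parameters are chosen layer by layer, each generic for a countable set of inputs that
depends only on `χ` and the earlier choices. The decoder `D` inverts the layers: a value reveals the
feature of its pair, which reveals the color of the edge. -/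
theorem exists_weights {N : ℕ} {χ : Set (Feature N)} (hχ : χ.Countable) :
    ∃ (θ : LGVRWeights N) (D : ℝ → Option (Sym2 (Feature N))),
      (∀ {V : Type v} [Fintype V] (g : SimpleGraph V) (c : V → Feature N), (∀ x, c x ∈ χ) →
        IsDecoder θ D g c ∧ ∀ e, edgeValue θ g c e ≤ 1 / 2) ∧
      ∀ k ∈ χ, ∃ a : ℝ, ∀ {V : Type v} [Fintype V] (g : SimpleGraph V)
        [∀ x, Fintype (g.neighborSet x)], (∀ x, g.degree x = 2) →
        ∀ e : (⊤ : SimpleGraph V).edgeSet,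
        ((e : Sym2 V) ∈ g.edgeSet → edgeValue θ g (fun _ => k) e = a) ∧
        ((e : Sym2 V) ∉ g.edgeSet → a < edgeValue θ g (fun _ => k) e) := by
  classical
  obtain ⟨w₀, hw₀⟩ := exists_separating_functional hχ
  -- The edge coloring depends only on `w₀`, so the remaining parameters can be filled with zeros
  -- here.
  let φ : Sym2 (Feature N) → Fin (N + N) → ℝ := phi (separatingWeights w₀ 0 0 0 0)
  have hφ : Set.InjOn φ (pairsOf χ) := injOn_phi hw₀
  let Φ : Set (Fin (N + N) → ℝ) := φ '' pairsOf χ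
  let Φs : Set (Fin (N + N) → ℝ) := AddSubmonoid.closure Φ
  have hΦ : Φ.Countable := (countable_pairsOf hχ).image _
  have hΦs : Φs.Countable := countable_addSubmonoid_closure hΦ
  obtain ⟨ε₁, -, hε₁⟩ := exists_separating_scalar hΦ hΦs
  let Y : Set (Fin (N + N) → ℝ) := Set.image2 (fun p s => (1 + ε₁) • p + s) Φ Φs
  have hY : Y.Countable := hΦ.image2 hΦs _
  obtain ⟨w, hw⟩ := exists_separating_functional hY
  obtain ⟨b, hb⟩ := exists_separating_bias (hY.image fun y => w ⬝ᵥ y)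
  let F : (Fin (N + N) → ℝ) → ℝ := fun y => |w ⬝ᵥ y + b|
  have hFpos : ∀ y ∈ Y, 0 < F y := fun y hy => abs_pos.2 fun h0 =>
    hb _ ⟨y, hy, rfl⟩ _ ⟨y, hy, rfl⟩ (by simp only [h0, neg_zero])
  have hFinj : Set.InjOn F Y := by
    intro y hy y' hy' h
    rcases abs_eq_abs.1 h with h | h
    · exact hw hy hy' (add_right_cancel h)
    · exact absurd h (hb _ ⟨y, hy, rfl⟩ _ ⟨y', hy', rfl⟩)
  -- The element `0` is the feature of the nonadjacent pairs; it differs from all edge features,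
  -- which are positive.
  let Z : Set ℝ := insert 0 (F '' Y)
  let Zs : Set ℝ := AddSubmonoid.closure Z
  have hZ : Z.Countable := (hY.image F).insert 0
  have hZs : Zs.Countable := countable_addSubmonoid_closure hZ
  obtain ⟨ε₂, hε₂, hε₂'⟩ := exists_separating_scalar hZ hZs
  let θ := separatingWeights w₀ ε₁ w b ε₂
  have hphi : phi θ = φ := rfl
  let IsColor (z : ℝ) (κ : Sym2 (Feature N)) : Prop :=
    κ ∈ pairsOf χ ∧ ∃ s ∈ Φs, z = F ((1 + ε₁) • φ κ + s)
  have hIsColor : ∀ {z κ κ'}, IsColor z κ → IsColor z κ' → κ = κ' := by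
    rintro z κ κ' ⟨hκ, s, hs, rfl⟩ ⟨hκ', s', hs', h⟩
    have hm : φ κ ∈ Φ := ⟨κ, hκ, rfl⟩
    have hm' : φ κ' ∈ Φ := ⟨κ', hκ', rfl⟩
    exact hφ hκ hκ' (hε₁ _ hm _ hm' _ hs _ hs' (hFinj ⟨_, hm, _, hs, rfl⟩ ⟨_, hm', _, hs', rfl⟩ h))
  let dec : ℝ → Option (Sym2 (Feature N)) := fun z =>
    if h : ∃ κ, IsColor z κ then some h.choose else none
  have hdec : ∀ {z κ}, IsColor z κ → dec z = some κ := fun {z κ} h => by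
    have h' : ∃ κ, IsColor z κ := ⟨κ, h⟩
    simp only [dec]
    rw [dif_pos h', hIsColor h'.choose_spec h]
  have hdec0 : dec 0 = none := by
    refine dif_neg ?_
    rintro ⟨κ, hκ, s, hs, h⟩
    exact (hFpos _ ⟨_, ⟨κ, hκ, rfl⟩, s, hs, rfl⟩).ne h
  let IsFeature (r z : ℝ) : Prop :=
    z ∈ Z ∧ ∃ s ∈ Zs, r = Real.sigmoid (-((1 + ε₂) • z + s))
  have hIsFeature : ∀ {r z z'}, IsFeature r z → IsFeature r z' → z = z' := by
    rintro r z z' ⟨hz, s, hs, rfl⟩ ⟨hz', s', hs', h⟩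
    exact hε₂' _ hz _ hz' _ hs _ hs' (neg_inj.1 (Real.sigmoid_injective h))
  let D : ℝ → Option (Sym2 (Feature N)) := fun r =>
    if h : ∃ z, IsFeature r z then dec h.choose else none
  have hD : ∀ {r z}, IsFeature r z → D r = dec z := fun {r z} h => by
    have h' : ∃ z, IsFeature r z := ⟨z, h⟩
    simp only [D]
    rw [dif_pos h', hIsFeature h'.choose_spec h]
  refine ⟨θ, D, fun {V} _ g c hc => ⟨?_, fun e => edgeValue_le_half g c hε₂ e⟩, ?_⟩
  · have hpairs : ∀ e : Sym2 V, e.map c ∈ pairsOf χ := by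
      intro e x hx
      obtain ⟨y, -, rfl⟩ := Sym2.mem_map.1 hx
      exact hc y
    have hcol : ∀ (e : (⊤ : SimpleGraph V).edgeSet) (h : (e : Sym2 V) ∈ g.edgeSet),
        IsColor (pairFeature w₀ ε₁ w b ε₂ g c e) ((e : Sym2 V).map c) := by
      intro e h
      rw [pairFeature, dif_pos h, lineFeatures_separatingWeights]
      exact ⟨hpairs _, _, sum_mem fun f _ => AddSubmonoid.subset_closure ⟨_, hpairs _, rfl⟩, rfl⟩
    have hmem : ∀ e, pairFeature w₀ ε₁ w b ε₂ g c e ∈ Z := by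
      intro e
      by_cases h : (e : Sym2 V) ∈ g.edgeSet
      · obtain ⟨hκ, s, hs, hz⟩ := hcol e h
        exact Or.inr ⟨_, ⟨_, ⟨_, hκ, rfl⟩, s, hs, rfl⟩, hz.symm⟩
      · left
        rw [pairFeature, dif_neg h]
    intro e
    have hf : IsFeature (edgeValue θ g c e) (pairFeature w₀ ε₁ w b ε₂ g c e) :=
      ⟨hmem e, _, sum_mem fun f _ => AddSubmonoid.subset_closure (hmem f),
        edgeValue_separatingWeights g c hε₂ e⟩
    rw [hD hf]
    split_ifs with h
    · exact hdec (hcol e h)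
    · rw [pairFeature, dif_neg h, hdec0]
  · intro k hk
    have hkk : φ s(k, k) ∈ Φ := by
      refine ⟨_, fun x hx => ?_, rfl⟩
      have : x = k := by simpa using hx
      exact this ▸ hk
    -- In a `2`-regular graph every edge has exactly two neighbors in the line graph.
    have hy : (1 + ε₁) • φ s(k, k) + 2 • φ s(k, k) ∈ Y :=
      ⟨_, hkk, _, nsmul_mem (AddSubmonoid.subset_closure hkk) 2, rfl⟩
    refine ⟨_, fun g _ hd e => edgeValue_of_regular hε₂ k (hFpos _ hy) rfl ?_ e⟩
    intro x
    rw [← hd x]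
    congr!

/-! ### The hexagon and the two triangles -/

section

variable {V W : Type v} {T : Type*} [LinearOrder T] {ι : T → ℝ} {o : T}
  {M : V → V → EReal} {w : Sym2 V → EReal} {M' : W → W → EReal} {w' : Sym2 W → EReal}

theorem pair_mem_iff {g : SimpleGraph V} [DecidableEq V] (hι : IsTimeAxis ι o)
    (hM : IsPairMatrix M w) {b : T}
    (hw : ∀ e : Sym2 V, ¬ e.IsDiag → (e ∈ g.edgeSet → w e = (ι b : EReal)) ∧
      (e ∉ g.edgeSet → (ι b : EReal) < w e)) {x y : V} (hxy : x ≠ y) :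
    ({x, y} : Finset V) ∈ ripsFiltration ι M b ↔ g.Adj x y := by
  have hd : ¬ (s(x, y)).IsDiag := by simpa using hxy
  rw [← Sym2.toFinset_mk_eq, toFinset_mem_vietorisRips hM hd (hι.nonneg b)]
  constructor
  · intro h
    by_contra hadj
    exact ((hw _ hd).2 hadj).not_ge h
  · exact fun h => ((hw _ hd).1 h).le

/-- If the edges of two graphs with equally many nodes appear first and at the same time, and only
one of the graphs is connected, then the `0`-th persistence diagrams are different. -/
theorem persistenceDiagram_zero_ne [Fintype V] [Fintype W] {g : SimpleGraph V} {h : SimpleGraph W}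
    (hι : IsTimeAxis ι o) (hM : IsPairMatrix M w) (hM' : IsPairMatrix M' w') {b : T} (hob : o < b)
    (hw : ∀ e : Sym2 V, ¬ e.IsDiag → (e ∈ g.edgeSet → w e = (ι b : EReal)) ∧
      (e ∉ g.edgeSet → (ι b : EReal) < w e))
    (hw' : ∀ e : Sym2 W, ¬ e.IsDiag → (e ∈ h.edgeSet → w' e = (ι b : EReal)) ∧
      (e ∉ h.edgeSet → (ι b : EReal) < w' e))
    (hcard : Fintype.card V = Fintype.card W) (hg : g.Connected) (f : W → ZMod 2)
    (hf : ∀ x y, h.Adj x y → f x = f y) {p q : W} (hp : f p = 0) (hq : f q = 1) :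
    persistenceDiagram 0 (ripsFiltration ι M) ≠ persistenceDiagram 0 (ripsFiltration ι M') := by
  classical
  intro heq
  have hle : ∀ e : Sym2 V, ¬ e.IsDiag → (ι b : EReal) ≤ w e := fun e he =>
    (em (e ∈ g.edgeSet)).elim (fun h => ((hw e he).1 h).ge) fun h => ((hw e he).2 h).le
  have hle' : ∀ e : Sym2 W, ¬ e.IsDiag → (ι b : EReal) ≤ w' e := fun e he =>
    (em (e ∈ h.edgeSet)).elim (fun h => ((hw' e he).1 h).ge) fun h => ((hw' e he).2 h).le
  -- At time `b` the complexes are the graphs themselves: with `n` nodes the connected one has rank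
  -- at least `n - 1`, the other at most `n - 2`.
  have h1 := card_le_finrank_boundaries_add_one hg (K := ripsFiltration ι M b)
    fun x y hxy => (pair_mem_iff hι hM hw hxy.ne).2 hxy
  have h2 := finrank_boundaries_add_two_le (K := ripsFiltration ι M' b) f (fun x y hxy => by
    rcases eq_or_ne x y with rfl | hne
    · rfl
    · exact hf x y ((pair_mem_iff hι hM' hw' hne).1 hxy)) hp hq
  rw [← persistenceDiagram_zero_first hι hM hob hle, heq] at h1
  rw [← persistenceDiagram_zero_first hι hM' hob hle'] at h2
  omega

end

/-- The disjoint union of two triangles. -/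
def twoTriangles : SimpleGraph (Fin 6) where
  Adj i j := i ≠ j ∧ (i < 3 ↔ j < 3)
  symm := ⟨fun _ _ h => ⟨h.1.symm, h.2.symm⟩⟩
  loopless := ⟨fun _ h => h.1 rfl⟩

instance : DecidableRel twoTriangles.Adj := fun i j =>
  inferInstanceAs (Decidable (i ≠ j ∧ (i < 3 ↔ j < 3)))

open Classical in
theorem exists_indistinguishable_pair {𝒢 : GraphSpace.{u, v}} (h𝒢 : ContainsAllFiniteGraphs 𝒢) :
    ∃ G H : 𝒢.Idx, (∀ x, (𝒢.graph G).degree x = 2) ∧ (∀ x, (𝒢.graph H).degree x = 2) ∧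
      Fintype.card (𝒢.V G) = 6 ∧ Fintype.card (𝒢.V H) = 6 ∧ (𝒢.graph G).Connected ∧
      ∃ f : 𝒢.V H → ZMod 2, (∀ x y, (𝒢.graph H).Adj x y → f x = f y) ∧
        ∃ p q, f p = 0 ∧ f q = 1 := by
  obtain ⟨G, ⟨φ⟩⟩ := h𝒢 6 (SimpleGraph.cycleGraph 6)
  obtain ⟨H, ⟨ψ⟩⟩ := h𝒢 6 twoTriangles
  refine ⟨G, H, fun x => ?_, fun x => ?_, ?_, ?_, ?_, fun x => if ψ.symm x < 3 then 0 else 1,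
    fun x y hxy => ?_, ψ 0, ψ 3, ?_, ?_⟩
  · rw [← φ.symm.degree_eq x]
    convert SimpleGraph.cycleGraph_degree_three_le (n := 3) (v := φ.symm x)
  · rw [← ψ.symm.degree_eq x]
    have : ∀ i, twoTriangles.degree i = 2 := by decide
    convert this (ψ.symm x)
  · rw [← Fintype.card_congr φ.toEquiv, Fintype.card_fin]
  · rw [← Fintype.card_congr ψ.toEquiv, Fintype.card_fin]
  · exact φ.connected_iff.1 SimpleGraph.cycleGraph_connected
  · simp only [(ψ.symm.map_rel_iff.2 hxy : twoTriangles.Adj (ψ.symm x) (ψ.symm y)).2]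
  · simp
  · simp

/-! ### Separation of a connected from a disconnected monochromatic graph -/

section

variable {𝒢 : GraphSpace.{u, v}} {N : ℕ} {C : NodeColoring 𝒢 N}

theorem TED_ne_of_regular {ef : Sym2 (Feature N) → ℝ} (hef : IsInjectiveEdgeFiltration C ef)
    {G H : 𝒢.Idx} {k : Feature N} (hG : ∀ x, C G x = k) (hH : ∀ x, C H x = k)
    (hcard : Fintype.card (𝒢.V G) = Fintype.card (𝒢.V H)) (hconn : (𝒢.graph G).Connected)
    (hk : s(k, k) ∈ coloredEdges C) (f : 𝒢.V H → ZMod 2)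
    (hf : ∀ x y, (𝒢.graph H).Adj x y → f x = f y) {p q : 𝒢.V H} (hp : f p = 0) (hq : f q = 1) :
    TED C ef G ≠ TED C ef H := by
  classical
  have hpos := hef.pos _ hk
  have hb : (0 : ℝ≥0) < ⟨ef s(k, k), hpos.le⟩ := hpos
  have key : ∀ J : 𝒢.Idx, (∀ x, C J x = k) → ∀ e : Sym2 (𝒢.V J), ¬ e.IsDiag →
      (e ∈ (𝒢.graph J).edgeSet → tedValue C ef J e = (ef s(k, k) : EReal)) ∧
      (e ∉ (𝒢.graph J).edgeSet → (ef s(k, k) : EReal) < tedValue C ef J e) := by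
    intro J hJ e _
    have hmap : e.map (C J) = s(k, k) := by
      induction e with | _ x y
      simp [hJ]
    refine ⟨fun he => ?_, fun he => ?_⟩
    · rw [tedValue, if_pos he, hmap]
    · rw [tedValue, if_neg he]
      exact EReal.coe_lt_top _
  exact fun h => persistenceDiagram_zero_ne isTimeAxis_nnreal (isPairMatrix_ted hef G)
    (isPairMatrix_ted hef H) hb (key G hG) (key H hH) hcard hconn f hf hp hq
    (congrArg Prod.fst h)

theorem LGVR_ne_of_regular {θ : LGVRWeights N} {V W : Type v} [Fintype V] [Fintype W]
    {g : SimpleGraph V} {c : V → Feature N} {h : SimpleGraph W} {c' : W → Feature N} {a : ℝ}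
    (ha : 0 < a) (ha' : a ≤ 1 / 2)
    (hg : ∀ e : (⊤ : SimpleGraph V).edgeSet, ((e : Sym2 V) ∈ g.edgeSet → edgeValue θ g c e = a) ∧
      ((e : Sym2 V) ∉ g.edgeSet → a < edgeValue θ g c e))
    (hh : ∀ e : (⊤ : SimpleGraph W).edgeSet, ((e : Sym2 W) ∈ h.edgeSet → edgeValue θ h c' e = a) ∧
      ((e : Sym2 W) ∉ h.edgeSet → a < edgeValue θ h c' e))
    (hcard : Fintype.card V = Fintype.card W) (hconn : g.Connected) (f : W → ZMod 2)
    (hf : ∀ x y, h.Adj x y → f x = f y) {p q : W} (hp : f p = 0) (hq : f q = 1) :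
    LGVR θ g c ≠ LGVR θ h c' := by
  classical
  have hb : (⟨0, by norm_num⟩ : Set.Icc (0 : ℝ) (1 / 2)) < ⟨a, ha.le, ha'⟩ := ha
  have key : ∀ {U : Type v} [Fintype U] (j : SimpleGraph U) (d : U → Feature N),
      (∀ e : (⊤ : SimpleGraph U).edgeSet, ((e : Sym2 U) ∈ j.edgeSet → edgeValue θ j d e = a) ∧
        ((e : Sym2 U) ∉ j.edgeSet → a < edgeValue θ j d e)) → ∀ e : Sym2 U, ¬ e.IsDiag →
      (e ∈ j.edgeSet → lgvrValue θ j d e = (a : EReal)) ∧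
      (e ∉ j.edgeSet → (a : EReal) < lgvrValue θ j d e) := by
    intro U _ j d hj e he
    have he' : e ∈ (⊤ : SimpleGraph U).edgeSet := by simpa using he
    rw [lgvrValue, dif_pos he']
    exact ⟨fun h => by rw [(hj ⟨e, he'⟩).1 h], fun h => by exact_mod_cast (hj ⟨e, he'⟩).2 h⟩
  exact fun heq => persistenceDiagram_zero_ne isTimeAxis_Icc (isPairMatrix_lgvr θ g c)
    (isPairMatrix_lgvr θ h c') hb (key g c hg) (key h c' hh) hcard hconn f hf hp hq
    (congrArg Prod.fst heq)

end

end TopEdge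

/-! ### The separation theorem -/

theorem theorem5p2 (N : ℕ) (χ : Set (TopEdge.Feature N)) (hχ : χ.Countable) :
    ∃ θ : TopEdge.LGVRWeights N,
      ∀ (𝒢 : TopEdge.GraphSpace.{u, v}) (C : TopEdge.NodeColoring 𝒢 N), (∀ G x, C G x ∈ χ) →
        (TopEdge.DegreeAssumption C →
          ∀ G H : 𝒢.Idx, TopEdge.NoIsolated (𝒢.graph G) → TopEdge.NoIsolated (𝒢.graph H) →
            TopEdge.colorMultiset C G ≠ TopEdge.colorMultiset C H →
            TopEdge.LGVR θ (𝒢.graph G) (C G) ≠ TopEdge.LGVR θ (𝒢.graph H) (C H) ∧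
            ∀ ef, TopEdge.IsInjectiveEdgeFiltration C ef →
              TopEdge.TED C ef G ≠ TopEdge.TED C ef H) ∧
        (TopEdge.IsStableWL C →
          (∀ G H : 𝒢.Idx, TopEdge.colorMultiset C G ≠ TopEdge.colorMultiset C H →
            TopEdge.LGVR θ (𝒢.graph G) (C G) ≠ TopEdge.LGVR θ (𝒢.graph H) (C H) ∧
            ∀ ef, TopEdge.IsInjectiveEdgeFiltration C ef →
              TopEdge.TED C ef G ≠ TopEdge.TED C ef H) ∧
          (TopEdge.ContainsAllFiniteGraphs 𝒢 →
            ∃ G H : 𝒢.Idx, TopEdge.colorMultiset C G = TopEdge.colorMultiset C H ∧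
              TopEdge.LGVR θ (𝒢.graph G) (C G) ≠ TopEdge.LGVR θ (𝒢.graph H) (C H) ∧
              ∀ ef, TopEdge.IsInjectiveEdgeFiltration C ef →
                TopEdge.TED C ef G ≠ TopEdge.TED C ef H)) := by
  obtain ⟨θ, D, hθ, hreg⟩ := TopEdge.exists_weights hχ
  have hLG : ∀ {𝒢 : TopEdge.GraphSpace.{u, v}} {C : TopEdge.NodeColoring 𝒢 N},
      (∀ G x, C G x ∈ χ) → ∀ {G H : 𝒢.Idx},
      TopEdge.LGVR θ (𝒢.graph G) (C G) = TopEdge.LGVR θ (𝒢.graph H) (C H) →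
      TopEdge.edgeColorMultiset (𝒢.graph G) (C G) =
        TopEdge.edgeColorMultiset (𝒢.graph H) (C H) := fun {𝒢 C} hC {G H} h =>
    TopEdge.edgeColorMultiset_eq_of_LGVR (hθ _ _ (hC G)).2 (hθ _ _ (hC H)).2
      (hθ _ _ (hC G)).1 (hθ _ _ (hC H)).1 h
  refine ⟨θ, fun 𝒢 C hC => ⟨fun hdeg G H hG hH hne => ⟨fun h => hne ?_, fun ef hef h => hne ?_⟩,
    fun hWL => ⟨fun G H hne => ⟨fun h => hne ?_, fun ef hef h => hne ?_⟩, fun hall => ?_⟩⟩⟩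
  · exact TopEdge.colorMultiset_eq_of_noIsolated hdeg (hLG hC h) hG hH
  · exact TopEdge.colorMultiset_eq_of_noIsolated hdeg
      (TopEdge.edgeColorMultiset_eq_of_TED hef h) hG hH
  · exact hWL.colorMultiset_eq (hLG hC h) (TopEdge.card_eq_of_LGVR h)
  · exact hWL.colorMultiset_eq (TopEdge.edgeColorMultiset_eq_of_TED hef h)
      (TopEdge.card_eq_of_TED hef h)
  · classical
    obtain ⟨G, H, hG, hH, hcG, hcH, hconn, f, hf, p, q, hp, hq⟩ :=
      TopEdge.exists_indistinguishable_pair hall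
    have hcard := hcG.trans hcH.symm
    obtain ⟨x₀⟩ := hconn.nonempty
    obtain ⟨y₀, hy₀⟩ : ∃ y, (𝒢.graph G).Adj x₀ y := by
      rw [← SimpleGraph.degree_pos_iff_exists_adj, hG]
      norm_num
    have hkG : ∀ x, C G x = C G x₀ := fun x =>
      (hWL _ _ _ _).2 fun t => TopEdge.wlColor_eq_of_regular hG hG t _ _
    have hkH : ∀ x, C H x = C G x₀ := fun x =>
      (hWL _ _ _ _).2 fun t => TopEdge.wlColor_eq_of_regular hH hG t _ _
    refine ⟨G, H, TopEdge.colorMultiset_eq_of_const hkG hkH hcard, ?_, fun ef hef =>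
      TopEdge.TED_ne_of_regular hef hkG hkH hcard hconn
        ⟨G, x₀, y₀, hy₀, by rw [hkG y₀]⟩ f hf hp hq⟩
    obtain ⟨a, ha⟩ := hreg (C G x₀) (hC G x₀)
    have hvG := ha (𝒢.graph G) hG
    have hvH := ha (𝒢.graph H) hH
    -- An actual edge shows that `a` is an edge value, hence lies in `(0, 1/2]`.
    have h0 := (hvG ⟨s(x₀, y₀), hy₀.ne⟩).1 hy₀
    rw [← (funext hkG : C G = fun _ => C G x₀)] at hvG h0
    rw [← (funext hkH : C H = fun _ => C G x₀)] at hvH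
    refine TopEdge.LGVR_ne_of_regular (a := a) ?_ ?_ hvG hvH hcard hconn f hf hp hq
    · exact h0 ▸ Real.sigmoid_pos _
    · exact h0 ▸ (hθ _ _ (hC G)).2 _
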